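/- Let $n\in\mathbb N$, $\sigma>1$, $1\le n<2\sigma$ and $\mu>0$. For $s\ge 0$ and $u_1\in L^1(\mathbb R^n)\cap L^2(\mathbb R^n)$ consider the Cauchy problem $$u_{tt}+(-\Delta)^\sigma u+\frac{\mu}{1+t}\,u_t=0\quad (t\ge s),\qquad u(s,\cdot)=0,\quad u_t(s,\cdot)=u_1 .$$ An energy solution is a function $u\in C([s,\infty),H^\sigma(\mathbb R^n))\cap C^1([s,\infty),L^2(\mathbb R^n))$ satisfying the initial conditions and $$\frac{d}{dt}\langle\varphi,\partial_tu(t)\rangle+\langle(-\Delta)^\sigma\varphi,u(t)\rangle+\frac{\mu}{1+t}\langle\varphi,\partial_tu(t)\rangle=0\qquad\text{for all }\varphi\in H^{2\sigma}(\mathbb R^n),\ t\ge s,$$ where $\langle\cdot,\cdot\rangle$ is the $L^2$ inner product. Put $\|f\|_{\dot H^\gamma}=\|\,|\xi|^\gamma\hat f\,\|_{L^2}$. Below, $X\lesssim Y$ means $X\le CY$ with a constant $C>0$ depending only on $n,\sigma,\mu,\gamma$, and not on $s$, $t$, $u_1$; all estimates are claimed for all $0\le s\le t$ and all $u_1\in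 L^1\cap L^2$. For every such $s$ and $u_1$ there is exactly one energy solution $u$. For every $\gamma\in[0,\sigma]$ it satisfies: **(i)** If $\mu>\max\{\frac{n+2\gamma}{\sigma},1\}$, then $$\|u(t,\cdot)\|_{\dot H^\gamma}\lesssim(1+t)^{-\frac n{2\sigma}-\frac\gamma\sigma}(1+s)\Big(\|u_1\|_{L^1}+(1+s)^{\frac n{2\sigma}}\|u_1\|_{L^2}\Big).$$ **(ii)** If $\max\{2-\frac n\sigma-\frac{2\gamma}\sigma,0\}<\mu<1$ or $1<\mu<\frac{n+2\gamma}\sigma$, then $$\|u(t,\cdot)\|_{\dot H^\gamma}\lesssim(1+t)^{-\frac\mu2}(1+s)^{1+\frac\mu2-\frac n{2\sigma}-\frac\gamma\sigma}\Big(\|u_1\|_{L^1}+(1+s)^{\frac n{2\sigma}}\|u_1\|_{L^2}\Big).$$ If $\mu=\frac{n+2\gamma}\sigma>1$, then $$\|u(t,\cdot)\|_{\dot H^\gamma}\lesssim(1+t)^{-\frac\mu2}(1+s)\Big(\Big(\ln\frac{e+t}{e+s}\Big)^{\frac12}\|u_1\|_{L^1}+(1+s)^{\frac n{2\sigma}}\|u_1\|_{L^2}\Big).$$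 If $\mu=2-\frac n\sigma-\frac{2\gamma}\sigma<1$, then $$\|u(t,\cdot)\|_{\dot H^\gamma}\lesssim(1+t)^{\frac n{2\sigma}-1+\frac\gamma\sigma}(1+s)^\mu\Big(\Big(\ln\frac{e+t}{e+s}\Big)^{\frac12}\|u_1\|_{L^1}+(1+s)^{\frac n{2\sigma}}\|u_1\|_{L^2}\Big).$$ **(iii)** If $0<\mu<\min\{2-\frac n\sigma-\frac{2\gamma}\sigma,1\}$, then $$\|u(t,\cdot)\|_{\dot H^\gamma}\lesssim(1+t)^{1-\mu-\frac n{2\sigma}-\frac\gamma\sigma}(1+s)^\mu\Big(\|u_1\|_{L^1}+(1+s)^{\frac n{2\sigma}}\|u_1\|_{L^2}\Big).$$ Moreover, $\|\partial_tu(t,\cdot)\|_{L^2}$ satisfies all the above estimates with $\gamma=\sigma$, in the corresponding ranges of $\mu$. -/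

import Mathlib

open MeasureTheory Filter Topology
open scoped FourierTransform ENNReal

noncomputable section

/-- The Hilbert space `L²(ℝⁿ)` of complex-valued functions. -/
abbrev L2 (n : ℕ) : Type := Lp (α := EuclideanSpace ℝ (Fin n)) ℂ 2 volume

/-- The homogeneous Sobolev norm `‖f‖_{Ḣ^γ} = ‖ |ξ|^γ f̂ ‖_{L²}` of an `L²` function, with value `∞`
when `f ∉ Ḣ^γ`. Mathlib's Fourier transform has the kernel `e^{-2πi⟨x,ξ⟩}`, so the frequency
variable `|ξ|` of the kernel `e^{-i⟨x,ξ⟩}` is `2π‖ξ‖` here. -/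
def homSobolevNorm {n : ℕ} (γ : ℝ) (f : L2 n) : ℝ≥0∞ :=
  eLpNorm (fun ξ : EuclideanSpace ℝ (Fin n) =>
    ((2 * Real.pi * ‖ξ‖) ^ γ : ℝ) • (𝓕 f : L2 n) ξ) 2 volume

/-- The inhomogeneous Sobolev norm `‖f‖_{H^r} = ‖ (1 + |ξ|²)^{r/2} f̂ ‖_{L²}` of an `L²` function,
with value `∞` when `f ∉ H^r`. -/
def sobolevNorm {n : ℕ} (r : ℝ) (f : L2 n) : ℝ≥0∞ :=
  eLpNorm (fun ξ : EuclideanSpace ℝ (Fin n) =>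
    ((1 + (2 * Real.pi * ‖ξ‖) ^ 2) ^ (r / 2) : ℝ) • (𝓕 f : L2 n) ξ) 2 volume

/-- `φ ∈ H^{2σ}` and `g = (-Δ)^σ φ`, that is, `ĝ = |ξ|^{2σ} φ̂` with both `φ` and `g` in `L²`. -/
def IsFracLaplacian {n : ℕ} (σ : ℝ) (φ g : L2 n) : Prop :=
  ∀ᵐ ξ : EuclideanSpace ℝ (Fin n),
    (𝓕 g : L2 n) ξ = ((2 * Real.pi * ‖ξ‖) ^ (2 * σ) : ℝ) • (𝓕 φ : L2 n) ξ

/-- `u` is an energy solution, with time derivative `v = ∂ₜu`, of the Cauchy problem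
`u_tt + (-Δ)^σ u + μ/(1+t) u_t = 0`, `u(s) = 0`, `u_t(s) = u₁`, on the time interval `[s, ∞)`:
`u ∈ C([s,∞), H^σ) ∩ C¹([s,∞), L²)`, and the equation holds weakly in space, tested against
every `φ ∈ H^{2σ}`. Values of `u` and `v` at times `t < s` play no role. -/
structure IsEnergySolution {n : ℕ} (σ μ s : ℝ) (u₁ : L2 n) (u v : ℝ → L2 n) : Prop where
  /-- `u(t) ∈ H^σ` -/
  mem_sobolev : ∀ t, s ≤ t → sobolevNorm σ (u t) < ∞
  /-- `u ∈ C([s,∞), H^σ)` -/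
  continuous_sobolev : ∀ t, s ≤ t →
    Tendsto (fun τ => sobolevNorm σ (u τ - u t)) (𝓝[Set.Ici s] t) (𝓝 0)
  /-- `v` is the derivative of `u : [s,∞) → L²` (one-sided at the initial time) -/
  hasDeriv : ∀ t, s ≤ t → HasDerivWithinAt u (v t) (Set.Ici s) t
  /-- `∂ₜu ∈ C([s,∞), L²)` -/
  continuous_deriv : ContinuousOn v (Set.Ici s)
  /-- the first initial condition -/
  initial : u s = 0
  /-- the second initial condition -/
  initial_deriv : v s = u₁
  /-- `d/dt ⟨φ, ∂ₜu⟩ + ⟨(-Δ)^σ φ, u⟩ + μ/(1+t) ⟨φ, ∂ₜu⟩ = 0` -/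
  equation : ∀ φ g : L2 n, IsFracLaplacian σ φ g → ∀ t, s ≤ t →
    HasDerivWithinAt (fun τ => inner ℂ φ (v τ))
      (-(inner ℂ g (u t)) - ((μ / (1 + t) : ℝ) : ℂ) * inner ℂ φ (v t)) (Set.Ici s) t

/-- `N (u(t)) (∂ₜu(t)) ≲ B s t ‖u₁‖_{L¹} ‖u₁‖_{L²}` for the energy solutions: the constant is the
same for all initial times `s ≥ 0`, all times `t ≥ s` and all data `u₁ ∈ L¹ ∩ L²`. -/
def SolutionBound (n : ℕ) (σ μ : ℝ) (N : L2 n → L2 n → ℝ≥0∞) (B : ℝ → ℝ → ℝ → ℝ → ℝ) : Prop :=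
  ∃ C : ℝ, 0 < C ∧ ∀ s : ℝ, 0 ≤ s → ∀ u₁ : L2 n, Integrable u₁ volume →
    ∀ u v : ℝ → L2 n, IsEnergySolution σ μ s u₁ u v → ∀ t : ℝ, s ≤ t →
      N (u t) (v t) ≤ ENNReal.ofReal (C * B s t (∫ x, ‖u₁ x‖) ‖u₁‖)

/-- The list of decay estimates of order `γ`, in all the regimes of `μ`, for the quantity
`N (u(t)) (∂ₜu(t))`. In the bounds, `a` stands for `‖u₁‖_{L¹}` and `b` for `‖u₁‖_{L²}`. -/
def DecayEstimates (n : ℕ) (σ μ γ : ℝ) (N : L2 n → L2 n → ℝ≥0∞) : Prop :=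
  (max ((n + 2 * γ) / σ) 1 < μ →
    SolutionBound n σ μ N fun s t a b =>
      (1 + t) ^ (-(n / (2 * σ)) - γ / σ) * (1 + s) * (a + (1 + s) ^ (n / (2 * σ)) * b)) ∧
  ((max (2 - n / σ - 2 * γ / σ) 0 < μ ∧ μ < 1) ∨ (1 < μ ∧ μ < (n + 2 * γ) / σ) →
    SolutionBound n σ μ N fun s t a b =>
      (1 + t) ^ (-(μ / 2)) * (1 + s) ^ (1 + μ / 2 - n / (2 * σ) - γ / σ) *
        (a + (1 + s) ^ (n / (2 * σ)) * b)) ∧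
  (μ = (n + 2 * γ) / σ ∧ 1 < μ →
    SolutionBound n σ μ N fun s t a b =>
      (1 + t) ^ (-(μ / 2)) * (1 + s) *
        (Real.log ((Real.exp 1 + t) / (Real.exp 1 + s)) ^ (1 / 2 : ℝ) * a +
          (1 + s) ^ (n / (2 * σ)) * b)) ∧
  (μ = 2 - n / σ - 2 * γ / σ ∧ μ < 1 →
    SolutionBound n σ μ N fun s t a b =>
      (1 + t) ^ (n / (2 * σ) - 1 + γ / σ) * (1 + s) ^ μ *
        (Real.log ((Real.exp 1 + t) / (Real.exp 1 + s)) ^ (1 / 2 : ℝ) * a +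
          (1 + s) ^ (n / (2 * σ)) * b)) ∧
  (0 < μ ∧ μ < min (2 - n / σ - 2 * γ / σ) 1 →
    SolutionBound n σ μ N fun s t a b =>
      (1 + t) ^ (1 - μ - n / (2 * σ) - γ / σ) * (1 + s) ^ μ *
        (a + (1 + s) ^ (n / (2 * σ)) * b))

end

/-! With `ρ = |ξ| ^ σ`, the Fourier transform turns the equation into a family of scalar ODEs `f'' +
ρ² f + μ / (1 + t) f' = 0`, `f s = 0`, `f' s = 1`, and the solution is `û(t) = f_ρ(t) û₁`.
Everything rests on bounds for `f` and `f'` that are uniform in `ρ`, `s`, `t`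
(`IsDampedMode.exists_zone_bounds`). As long as `ρ (1 + t) ≤ 1`, the term `ρ² f` is a perturbation
and `f` is bounded by a multiple of `(1 + s) ^ m (1 + t) ^ (1 - m)`, `m = min μ 1`
(`low_frequency_bound`). Once `ρ (1 + t) ≥ 1`, `(1 + t) ^ (μ / 2) f` solves an oscillator equation
with an integrable perturbation, so the energy decays like `(1 + t) ^ (-μ)` (`energy_decay`). A mode
with `ρ (1 + s) ≤ 1 ≤ ρ (1 + t)` changes regime at the time where `ρ (1 + t) = 1`.

With `S = 1 + s`, `T = 1 + t`, a multiplier of order `b` (`b = γ / σ`, or `b = 1` for `∂ₜu`) is then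
bounded by a constant times `S ^ m T ^ (-μ / 2) x ^ e`, where `e = μ / 2 + 1 - m - b` and `x` is
`T`, `1 / ρ`, `S` in the zones `ρ ≤ 1 / T`, `1 / T ≤ ρ ≤ 1 / S`, `ρ ≥ 1 / S`. On `ρ ≥ 1 / S` it is
paired with the `L²` norm of `û₁`; on `ρ ≤ 1 / S` its `L²` norm is paired with `‖û₁‖_∞ ≤ ‖u₁‖_{L¹}`.
Since `dξ` is of the size `ρ ^ (n / σ - 1) dρ`, this `L²` norm involves `∫ ρ ^ (θ - 1) dρ` over `1 /
T ≤ ρ ≤ 1 / S` with `θ = n / σ - 2 e`. The regimes of the theorem are the cases `θ < 0`, `θ > 0`, `θ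
= 0` (the logarithm), each for `μ < 1` and `μ > 1`.

The multiplier formula does define an energy solution (`exists_isEnergySolution`), and by uniqueness
(`IsEnergySolution.unique`) the bounds apply to every energy solution. -/

/-! ### Linear ODEs depending on a parameter. -/

section LinearODE

variable {E : Type*} [NormedAddCommGroup E] [NormedSpace ℝ E]
  {Λ : Type*} [TopologicalSpace Λ]

/-- The terms of the Picard series of the linear equation `y' = A y`, `y s = x`. -/
noncomputable def picardTerm (A : Λ → ℝ → E →L[ℝ] E) (s : ℝ) (x : E) : ℕ → Λ → ℝ → E
  | 0 => fun _ _ => x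
  | k + 1 => fun l t => ∫ τ in s..t, A l τ (picardTerm A s x k l τ)

theorem continuous_picardTerm {A : Λ → ℝ → E →L[ℝ] E} (hA : Continuous (Function.uncurry A))
    (s : ℝ) (x : E) (k : ℕ) : Continuous (Function.uncurry (picardTerm A s x k)) := by
  induction k with
  | zero => exact continuous_const
  | succ k ih =>
    have h : Continuous fun p : (Λ × ℝ) × ℝ => A p.1.1 p.2 (picardTerm A s x k p.1.1 p.2) := by
      have h1 : Continuous fun p : (Λ × ℝ) × ℝ => (p.1.1, p.2) := by fun_prop
      exact (hA.comp h1).clm_apply (ih.comp h1)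
    exact intervalIntegral.continuous_parametric_intervalIntegral_of_continuous
      (f := fun (p : Λ × ℝ) τ => A p.1 τ (picardTerm A s x k p.1 τ)) h continuous_snd

theorem hasDerivAt_picardTerm_succ [CompleteSpace E] {A : Λ → ℝ → E →L[ℝ] E}
    (hA : Continuous (Function.uncurry A)) (s : ℝ) (x : E) (k : ℕ) (l : Λ) (t : ℝ) :
    HasDerivAt (picardTerm A s x (k + 1) l) (A l t (picardTerm A s x k l t)) t := by
  have h : Continuous fun τ => A l τ (picardTerm A s x k l τ) := by
    have h1 : Continuous fun τ : ℝ => (l, τ) := by fun_prop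
    exact (hA.comp h1).clm_apply ((continuous_picardTerm hA s x k).comp h1)
  exact intervalIntegral.integral_hasDerivAt_right (h.intervalIntegrable _ _)
    h.stronglyMeasurable.stronglyMeasurableAtFilter h.continuousAt

theorem norm_picardTerm_le {A : Λ → ℝ → E →L[ℝ] E} (hA : Continuous (Function.uncurry A))
    (s : ℝ) (x : E) (l : Λ) {R M : ℝ} (hM : ∀ t ∈ Metric.ball s R, ‖A l t‖ ≤ M) (k : ℕ)
    (t : ℝ) (ht : t ∈ Metric.ball s R) :
    ‖picardTerm A s x k l t‖ ≤ M ^ k * |t - s| ^ k / k.factorial * ‖x‖ := by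
  have hM0 : 0 ≤ M := (norm_nonneg _).trans (hM t ht)
  induction k generalizing t with
  | zero => simp [picardTerm]
  | succ k ih =>
    have hsub : ∀ τ ∈ Set.uIoc s t, τ ∈ Metric.ball s R := by
      intro τ hτ
      have := Set.abs_sub_left_of_mem_uIcc (Set.uIoc_subset_uIcc hτ)
      rw [Metric.mem_ball, Real.dist_eq] at ht ⊢
      exact this.trans_lt ht
    have h1 : ∀ τ ∈ Set.uIoc s t, ‖A l τ (picardTerm A s x k l τ)‖
        ≤ M ^ (k + 1) / k.factorial * ‖x‖ * |τ - s| ^ k := by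
      intro τ hτ
      calc _ ≤ ‖A l τ‖ * ‖picardTerm A s x k l τ‖ := (A l τ).le_opNorm _
        _ ≤ M * (M ^ k * |τ - s| ^ k / k.factorial * ‖x‖) := by
          gcongr
          · exact hM τ (hsub τ hτ)
          · exact ih τ (hsub τ hτ)
        _ = _ := by ring
    have hc : Continuous fun τ => A l τ (picardTerm A s x k l τ) := by
      have h1 : Continuous fun τ : ℝ => (l, τ) := by fun_prop
      exact (hA.comp h1).clm_apply ((continuous_picardTerm hA s x k).comp h1)
    calc ‖picardTerm A s x (k + 1) l t‖
        ≤ ∫ τ in Set.uIoc s t, ‖A l τ (picardTerm A s x k l τ)‖ :=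
          intervalIntegral.norm_integral_le_integral_norm_uIoc
      _ ≤ ∫ τ in Set.uIoc s t, M ^ (k + 1) / k.factorial * ‖x‖ * |τ - s| ^ k := by
          refine setIntegral_mono_on ?_ ?_ measurableSet_uIoc h1
          · exact (hc.norm.intervalIntegrable s t).def'
          · exact (Continuous.intervalIntegrable (by fun_prop) s t).def'
      _ = _ := by
          rw [integral_const_mul, integral_pow_abs_sub_uIoc, Nat.factorial_succ]
          push_cast
          field_simp

/-- On each ball around `s` the Picard terms are dominated by an exponential series, so the series
can be differentiated term by term. The series is used because its terms are continuous in the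
parameter: the solution is a pointwise limit of continuous functions of `l`, hence measurable in
`l`, as a Fourier multiplier must be. -/
theorem exists_linear_ode_solution [CompleteSpace E] [SecondCountableTopology E]
    [MeasurableSpace E] [BorelSpace E]
    [MeasurableSpace Λ] [OpensMeasurableSpace Λ] {A : Λ → ℝ → E →L[ℝ] E}
    (hA : Continuous (Function.uncurry A)) (s : ℝ) (x : E) :
    ∃ y : Λ → ℝ → E, (∀ l, y l s = x) ∧ (∀ l t, HasDerivAt (y l) (A l t (y l t)) t) ∧
      ∀ t, Measurable fun l => y l t := by
  have hAl : ∀ l, Continuous (A l) := fun l => hA.comp (by fun_prop : Continuous fun τ => (l, τ))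
  have key : ∀ l R, 0 < R → ∃ u : ℕ → ℝ, Summable u ∧
      (∀ k, ∀ t ∈ Metric.ball s R, ‖picardTerm A s x k l t‖ ≤ u k) ∧ ∃ M, 0 ≤ M ∧
        ∀ t ∈ Metric.ball s R, ‖A l t‖ ≤ M := by
    intro l R hR
    obtain ⟨M, hM⟩ := (isCompact_closedBall s R).exists_bound_of_continuousOn (hAl l).continuousOn
    have hM' : ∀ t ∈ Metric.ball s R, ‖A l t‖ ≤ M :=
      fun t ht => hM t (Metric.ball_subset_closedBall ht)
    have hM0 : 0 ≤ M := (norm_nonneg _).trans (hM' s (Metric.mem_ball_self hR))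
    refine ⟨fun k => (M * R) ^ k / k.factorial * ‖x‖,
      (Real.summable_pow_div_factorial _).mul_right _, fun k t ht => ?_, M, hM0, hM'⟩
    refine (norm_picardTerm_le hA s x l hM' k t ht).trans ?_
    simp only [mul_pow]
    gcongr
    rw [Metric.mem_ball, Real.dist_eq] at ht
    exact ht.le
  have hsum : ∀ l t, Summable fun k => picardTerm A s x k l t := by
    intro l t
    obtain ⟨u, hu, hb, -⟩ := key l (|t - s| + 1) (by positivity)
    exact .of_norm_bounded hu fun k => hb k t (by simp [Metric.mem_ball, Real.dist_eq])
  refine ⟨fun l t => ∑' k, picardTerm A s x k l t, fun l => ?_, fun l t => ?_, fun t => ?_⟩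
  · change ∑' k, picardTerm A s x k l s = x
    rw [tsum_eq_single 0]
    · rfl
    · intro k hk
      obtain ⟨k, rfl⟩ := Nat.exists_eq_succ_of_ne_zero hk
      simp [picardTerm]
  · obtain ⟨u, hu, hb, M, hM0, hM⟩ := key l (|t - s| + 1) (by positivity)
    have ht : t ∈ Metric.ball s (|t - s| + 1) := by simp [Metric.mem_ball, Real.dist_eq]
    have hs : s ∈ Metric.ball s (|t - s| + 1) := Metric.mem_ball_self (by positivity)
    have h1 := hasDerivAt_tsum_of_isPreconnected (g := fun k => picardTerm A s x (k + 1) l)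
      (g' := fun k t => A l t (picardTerm A s x k l t)) (u := fun k => M * u k)
      (hu.mul_left M) Metric.isOpen_ball (convex_ball _ _).isPreconnected
      (fun k y _ => hasDerivAt_picardTerm_succ hA s x k l y)
      (fun k y hy => ((A l y).le_opNorm _).trans
        (mul_le_mul (hM y hy) (hb k y hy) (norm_nonneg _) hM0)) hs
      ((summable_nat_add_iff 1).2 (hsum l s)) ht
    rw [← ContinuousLinearMap.map_tsum _ (hsum l t)] at h1
    have h2 : (fun t => ∑' k, picardTerm A s x k l t)
        = fun t => x + ∑' k, picardTerm A s x (k + 1) l t := by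
      funext r
      rw [(hsum l r).tsum_eq_zero_add]
      rfl
    change HasDerivAt (fun t => ∑' k, picardTerm A s x k l t) _ t
    rw [h2]
    exact h1.const_add x
  · refine measurable_of_tendsto_metrizable (fun N => ?_)
      (tendsto_pi_nhds.2 fun l => (hsum l t).hasSum.tendsto_sum_nat)
    refine Continuous.measurable ?_
    exact continuous_finsetSum _ fun k _ =>
      (continuous_picardTerm hA s x k).comp (by fun_prop : Continuous fun l : Λ => (l, t))

end LinearODE

/-! ### A single Fourier mode: energy decay and low frequencies. -/

/-- `g = f'` and `f'' + ρ² f + μ / (1 + t) f' = 0` for `t ≥ s`, with `f s = 0` and `f' s = 1`. -/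
structure IsDampedMode (μ s ρ : ℝ) (f g : ℝ → ℝ) : Prop where
  deriv : ∀ t, s ≤ t → HasDerivAt f (g t) t
  deriv₂ : ∀ t, s ≤ t → HasDerivAt g (-(ρ ^ 2 * f t) - μ / (1 + t) * g t) t
  initial : f s = 0
  initial_deriv : g s = 1

theorem exists_isDampedMode (μ : ℝ) {s : ℝ} (hs : 0 ≤ s) :
    ∃ f g : ℝ → ℝ → ℝ, (∀ ρ, IsDampedMode μ s ρ (f ρ) (g ρ)) ∧
      (∀ t, Measurable fun ρ => f ρ t) ∧ ∀ t, Measurable fun ρ => g ρ t := by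
  -- The truncation `max t 0` makes the coefficient continuous on the whole line and changes nothing
  -- for `t ≥ s ≥ 0`.
  let A : ℝ → ℝ → (ℝ × ℝ) →L[ℝ] (ℝ × ℝ) := fun ρ t =>
    (ContinuousLinearMap.inl ℝ ℝ ℝ) ∘L (ContinuousLinearMap.snd ℝ ℝ ℝ)
      - ρ ^ 2 • ((ContinuousLinearMap.inr ℝ ℝ ℝ) ∘L (ContinuousLinearMap.fst ℝ ℝ ℝ))
      - (μ / (1 + max t 0)) • ((ContinuousLinearMap.inr ℝ ℝ ℝ) ∘L (ContinuousLinearMap.snd ℝ ℝ ℝ))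
  have hA : Continuous (Function.uncurry A) := by
    have h : Continuous fun p : ℝ × ℝ => μ / (1 + max p.2 0) :=
      continuous_const.div (by fun_prop) fun p => by positivity
    exact (continuous_const.sub ((continuous_fst.pow 2).smul continuous_const)).sub
      (h.smul continuous_const)
  obtain ⟨y, hy0, hy, hym⟩ := exists_linear_ode_solution hA s ((0, 1) : ℝ × ℝ)
  refine ⟨fun ρ t => (y ρ t).1, fun ρ t => (y ρ t).2, fun ρ => ⟨fun t _ => ?_, fun t ht => ?_,
    by simp [hy0], by simp [hy0]⟩, fun t => (hym t).fst, fun t => (hym t).snd⟩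
  · have h := (ContinuousLinearMap.fst ℝ ℝ ℝ).hasFDerivAt.comp_hasDerivAt t (hy ρ t)
    simp only [A, ContinuousLinearMap.coe_fst'] at h
    convert! h using 1
    simp
  · have h := (ContinuousLinearMap.snd ℝ ℝ ℝ).hasFDerivAt.comp_hasDerivAt t (hy ρ t)
    simp only [A, ContinuousLinearMap.coe_snd'] at h
    convert! h using 1
    simp [max_eq_left (hs.trans ht)]

namespace IsDampedMode

variable {μ s ρ : ℝ} {f g : ℝ → ℝ}

/-- The damping dissipates: the derivative of the energy is `-2 μ / (1 + t) g²`, and the energy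
equals `1` at time `s`. -/
theorem energy_le_one (h : IsDampedMode μ s ρ f g) (hμ : 0 ≤ μ) (hs : 0 ≤ s) {t : ℝ}
    (ht : s ≤ t) : g t ^ 2 + ρ ^ 2 * f t ^ 2 ≤ 1 := by
  have hd : ∀ τ, s ≤ τ → HasDerivAt (fun τ => g τ ^ 2 + ρ ^ 2 * f τ ^ 2)
      (-(2 * (μ / (1 + τ)) * g τ ^ 2)) τ := by
    intro τ hτ
    convert! ((h.deriv₂ τ hτ).pow 2).add (((h.deriv τ hτ).pow 2).const_mul (ρ ^ 2)) using 1
    simp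
    ring
  have hanti : AntitoneOn (fun τ => g τ ^ 2 + ρ ^ 2 * f τ ^ 2) (Set.Ici s) := by
    refine antitoneOn_of_deriv_nonpos (convex_Ici s)
      (fun τ hτ => (hd τ hτ).continuousAt.continuousWithinAt)
      (fun τ hτ => (hd τ (interior_subset hτ)).differentiableAt.differentiableWithinAt)
      fun τ hτ => ?_
    have hτ' : s ≤ τ := interior_subset hτ
    rw [(hd τ hτ').deriv]
    have : 0 ≤ 2 * (μ / (1 + τ)) * g τ ^ 2 := by
      have : 0 ≤ 1 + τ := by linarith
      positivity
    linarith
  have := hanti (Set.mem_Ici.2 le_rfl) (Set.mem_Ici.2 ht) ht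
  simpa [h.initial, h.initial_deriv] using this

theorem abs_deriv_le_one (h : IsDampedMode μ s ρ f g) (hμ : 0 ≤ μ) (hs : 0 ≤ s) {t : ℝ}
    (ht : s ≤ t) : |g t| ≤ 1 := by
  have := h.energy_le_one hμ hs ht
  exact abs_le_one_iff_mul_self_le_one.2 (by nlinarith [sq_nonneg (ρ * f t)])

theorem abs_mul_le_one (h : IsDampedMode μ s ρ f g) (hμ : 0 ≤ μ) (hs : 0 ≤ s) {t : ℝ}
    (ht : s ≤ t) : |ρ * f t| ≤ 1 := by
  have := h.energy_le_one hμ hs ht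
  exact abs_le_one_iff_mul_self_le_one.2 (by nlinarith [sq_nonneg (g t)])

theorem abs_le_sub (h : IsDampedMode μ s ρ f g) (hμ : 0 ≤ μ) (hs : 0 ≤ s) {t : ℝ}
    (ht : s ≤ t) : |f t| ≤ t - s := by
  have := norm_image_sub_le_of_norm_deriv_le_segment' (f := f) (f' := g) (a := s) (b := t) (C := 1)
    (fun τ hτ => (h.deriv τ hτ.1).hasDerivWithinAt)
    (fun τ hτ => h.abs_deriv_le_one hμ hs hτ.1) t ⟨ht, le_rfl⟩
  simpa [h.initial] using this

/-- The energy decays like `(1 + t) ^ (-μ)` as soon as `ρ (1 + t) ≥ 1`. -/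
theorem energy_decay (h : IsDampedMode μ s ρ f g) (hs : 0 ≤ s) (hρ : 0 < ρ)
    {t₀ t : ℝ} (ht₀ : s ≤ t₀) (ht : t₀ ≤ t) (h1 : 1 ≤ ρ * (1 + t₀)) :
    (1 + t) ^ μ * (g t ^ 2 + ρ ^ 2 * f t ^ 2) ≤
      (2 + μ ^ 2) ^ 2 * Real.exp |μ / 2 * (μ / 2 - 1)| *
        ((1 + t₀) ^ μ * (g t₀ ^ 2 + ρ ^ 2 * f t₀ ^ 2)) := by
  set c : ℝ := |μ / 2 * (μ / 2 - 1)| with hc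
  have hc0 : 0 ≤ c := abs_nonneg _
  -- With `w = (1 + τ) ^ (μ / 2) f`, the product `(1 + τ) ^ μ N` is `w' ^ 2 + ρ ^ 2 w ^ 2`. The
  -- substitution removes the damping: `w'' = (-ρ² + (μ / 2) (μ / 2 - 1) / (1 + τ)²) w`.
  let N : ℝ → ℝ := fun τ => (g τ + μ / 2 * (f τ / (1 + τ))) ^ 2 + ρ ^ 2 * f τ ^ 2
  let N' : ℝ → ℝ := fun τ => 2 * (g τ + μ / 2 * (f τ / (1 + τ))) *
    (-(ρ ^ 2 * f τ) - μ / (1 + τ) * g τ + μ / 2 * (g τ / (1 + τ) - f τ / (1 + τ) ^ 2))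
    + ρ ^ 2 * (2 * f τ * g τ)
  have hT : ∀ τ, s ≤ τ → 0 < 1 + τ := fun τ hτ => by linarith
  have hid : ∀ τ, HasDerivAt (fun τ : ℝ => 1 + τ) 1 τ := fun τ => (hasDerivAt_id τ).const_add 1
  have hN : ∀ τ, s ≤ τ → HasDerivAt N (N' τ) τ := by
    intro τ hτ
    have hne := (hT τ hτ).ne'
    convert! (((h.deriv₂ τ hτ).add (((h.deriv τ hτ).div (hid τ) hne).const_mul (μ / 2))).pow 2).add
      (((h.deriv τ hτ).pow 2).const_mul (ρ ^ 2)) using 1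
    simp only [N', Pi.add_apply, Pi.div_apply, Nat.cast_ofNat, Nat.add_one_sub_one, pow_one, mul_one]
    field_simp
  -- The energy of `w` grows at a relative rate of at most `c / (ρ (1 + τ)²)`, because `2 |w w'|` is
  -- at most that energy divided by `ρ`. The exponential factor compensates exactly this rate, so
  -- `H` is nonincreasing; its exponent lies in `[0, c]` once `ρ (1 + τ) ≥ 1`.
  let H : ℝ → ℝ := fun τ => ((1 + τ) ^ μ * N τ) * Real.exp (c / ρ * (1 + τ)⁻¹)
  have hH : ∀ τ, s ≤ τ → HasDerivAt H ((1 + τ) ^ μ * Real.exp (c / ρ * (1 + τ)⁻¹) *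
      (μ / (1 + τ) * N τ + N' τ - c / ρ / (1 + τ) ^ 2 * N τ)) τ := by
    intro τ hτ
    have hne := (hT τ hτ).ne'
    convert! (((hid τ).rpow_const (p := μ) (Or.inl hne)).mul (hN τ hτ)).mul
      (((hid τ).inv hne).const_mul (c / ρ)).exp using 1
    rw [Real.rpow_sub_one hne]
    simp
    field_simp
    ring
  have hanti : AntitoneOn H (Set.Ici s) := by
    refine antitoneOn_of_deriv_nonpos (convex_Ici s)
      (fun τ hτ => (hH τ hτ).continuousAt.continuousWithinAt)
      (fun τ hτ => (hH τ (interior_subset hτ)).differentiableAt.differentiableWithinAt)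
      fun τ hτ => ?_
    have hτ' : s ≤ τ := interior_subset hτ
    have hp := hT τ hτ'
    rw [(hH τ hτ').deriv]
    refine mul_nonpos_of_nonneg_of_nonpos (by positivity) ?_
    have e1 : μ / (1 + τ) * N τ + N' τ =
        2 * (μ / 2 * (μ / 2 - 1)) / (1 + τ) ^ 2 * (f τ * (g τ + μ / 2 * (f τ / (1 + τ)))) := by
      simp only [N, N']
      field_simp
      ring
    rw [e1]
    set P := g τ + μ / 2 * (f τ / (1 + τ)) with hP
    have e2 : 2 * |f τ * P| ≤ N τ / ρ := by
      rw [le_div_iff₀ hρ, abs_mul]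
      simp only [N, ← hP]
      nlinarith [sq_nonneg (|P| - ρ * |f τ|), sq_abs P, sq_abs (f τ)]
    have e3 : 2 * (μ / 2 * (μ / 2 - 1)) * (f τ * P) ≤ c * (N τ / ρ) := by
      calc 2 * (μ / 2 * (μ / 2 - 1)) * (f τ * P) = (μ / 2 * (μ / 2 - 1)) * (2 * (f τ * P)) := by ring
        _ ≤ |(μ / 2 * (μ / 2 - 1)) * (2 * (f τ * P))| := le_abs_self _
        _ = c * (2 * |f τ * P|) := by rw [abs_mul, abs_mul 2, hc]; simp
        _ ≤ _ := by gcongr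
    have e4 : (2 * (μ / 2 * (μ / 2 - 1)) * (f τ * P)) / (1 + τ) ^ 2
        ≤ c * (N τ / ρ) / (1 + τ) ^ 2 := by gcongr
    have e5 : c / ρ / (1 + τ) ^ 2 * N τ = c * (N τ / ρ) / (1 + τ) ^ 2 := by ring
    rw [e5, sub_nonpos]
    refine le_trans (le_of_eq ?_) e4
    ring
  have hle := hanti (Set.mem_Ici.2 ht₀) (Set.mem_Ici.2 (ht₀.trans ht)) ht
  have hinv : ∀ τ, t₀ ≤ τ → (1 + τ)⁻¹ ≤ ρ := by
    intro τ hτ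
    have := hT τ (ht₀.trans hτ)
    rw [inv_le_iff_one_le_mul₀ this]
    exact h1.trans (by gcongr)
  have hfd : ∀ τ, t₀ ≤ τ → (f τ / (1 + τ)) ^ 2 ≤ ρ ^ 2 * f τ ^ 2 := by
    intro τ hτ
    have := hT τ (ht₀.trans hτ)
    rw [div_eq_mul_inv, mul_pow, mul_comm]
    gcongr
    exact hinv τ hτ
  -- After `t₀` one has `|f| / (1 + τ) ≤ ρ |f|`, so `N` and the energy are comparable. Passing from
  -- one to the other and back costs `(2 + μ ^ 2) ^ 2`.
  have hN1 : ∀ τ, t₀ ≤ τ → N τ ≤ (2 + μ ^ 2) * (g τ ^ 2 + ρ ^ 2 * f τ ^ 2) := by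
    intro τ hτ
    have h2 := hfd τ hτ
    have h3 : μ ^ 2 * (f τ / (1 + τ)) ^ 2 ≤ μ ^ 2 * (ρ ^ 2 * f τ ^ 2) := by gcongr
    simp only [N]
    nlinarith [sq_nonneg (g τ - μ / 2 * (f τ / (1 + τ))), sq_nonneg (μ * g τ),
      sq_nonneg (ρ * f τ), sq_nonneg (μ * (ρ * f τ))]
  have hN2 : ∀ τ, t₀ ≤ τ → g τ ^ 2 + ρ ^ 2 * f τ ^ 2 ≤ (2 + μ ^ 2) * N τ := by
    intro τ hτ
    have h2 := hfd τ hτ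
    have h3 : μ ^ 2 * (f τ / (1 + τ)) ^ 2 ≤ μ ^ 2 * (ρ ^ 2 * f τ ^ 2) := by gcongr
    simp only [N]
    set P := g τ + μ / 2 * (f τ / (1 + τ)) with hP
    have h4 : g τ = P - μ / 2 * (f τ / (1 + τ)) := by rw [hP]; ring
    rw [h4]
    nlinarith [sq_nonneg (P + μ / 2 * (f τ / (1 + τ))), sq_nonneg (μ * P),
      sq_nonneg (ρ * f τ), sq_nonneg (μ * (ρ * f τ))]
  have hpt := hT t (ht₀.trans ht)
  have hpt₀ := hT t₀ ht₀
  have hN0 : ∀ τ, 0 ≤ N τ := fun τ => by positivity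
  calc (1 + t) ^ μ * (g t ^ 2 + ρ ^ 2 * f t ^ 2)
      ≤ (1 + t) ^ μ * ((2 + μ ^ 2) * N t) := by gcongr; exact hN2 t ht
    _ = (2 + μ ^ 2) * ((1 + t) ^ μ * N t * 1) := by ring
    _ ≤ (2 + μ ^ 2) * H t := by
        simp only [H]
        gcongr
        exact Real.one_le_exp (by positivity)
    _ ≤ (2 + μ ^ 2) * H t₀ := by gcongr
    _ ≤ (2 + μ ^ 2) * ((1 + t₀) ^ μ * ((2 + μ ^ 2) * (g t₀ ^ 2 + ρ ^ 2 * f t₀ ^ 2))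
          * Real.exp c) := by
        simp only [H]
        gcongr
        · exact hN1 t₀ le_rfl
        · calc c / ρ * (1 + t₀)⁻¹ ≤ c / ρ * ρ := by
                gcongr
                exact hinv t₀ le_rfl
            _ = c := by field_simp
    _ = _ := by ring

/-- In the zone `ρ (1 + t) ≤ 1` the solution is comparable to the one for `ρ = 0`. -/
theorem low_frequency_bound (h : IsDampedMode μ s ρ f g) (hμ : 0 ≤ μ) (hμ1 : μ ≠ 1) (hs : 0 ≤ s)
    (hρ : 0 ≤ ρ) {t : ℝ} (ht : s ≤ t) (h1 : ρ * (1 + t) ≤ 1) :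
    |f t| ≤ 2 / |1 - μ| * ((1 + s) ^ min μ 1 * (1 + t) ^ (1 - min μ 1)) ∧
    (1 + t) * |g t| ≤ (1 + 2 / |1 - μ|) * ((1 + s) ^ min μ 1 * (1 + t) ^ (1 - min μ 1)) := by
  have hT : ∀ τ, s ≤ τ → 0 < 1 + τ := fun τ hτ => by linarith
  have hid : ∀ τ, HasDerivAt (fun τ : ℝ => 1 + τ) 1 τ := fun τ => (hasDerivAt_id τ).const_add 1
  have hS := hT s le_rfl
  have hTt := hT t ht
  obtain ⟨x₀, hx₀, hmax⟩ := (isCompact_Icc (a := s) (b := t)).exists_isMaxOn ⟨s, le_rfl, ht⟩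
    (f := fun τ => |f τ|) (fun τ hτ => (h.deriv τ hτ.1).continuousAt.continuousWithinAt.abs)
  set M := |f x₀| with hM
  have hM0 : 0 ≤ M := abs_nonneg _
  have hfM : ∀ τ ∈ Set.Icc s t, |f τ| ≤ M := fun τ hτ => hmax hτ
  -- From `((1 + r) ^ μ g)' = -ρ² (1 + r) ^ μ f`, with `|f|` replaced by its maximum `M` on `[s,
  -- t]`.
  have hg : ∀ τ ∈ Set.Icc s t, |g τ| ≤ (1 + s) ^ μ * (1 + τ) ^ (-μ) + ρ ^ 2 * M * (τ - s) := by
    intro τ hτ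
    have hp := hT τ hτ.1
    have := norm_image_sub_le_of_norm_deriv_le_segment' (f := fun r => (1 + r) ^ μ * g r)
      (f' := fun r => -(ρ ^ 2 * ((1 + r) ^ μ * f r))) (a := s) (b := τ)
      (C := ρ ^ 2 * ((1 + τ) ^ μ * M))
      (fun r hr => by
        have hne := (hT r hr.1).ne'
        refine HasDerivAt.hasDerivWithinAt ?_
        convert! ((hid r).rpow_const (p := μ) (Or.inl hne)).mul (h.deriv₂ r hr.1) using 1
        rw [Real.rpow_sub_one hne]
        field_simp
        ring)
      (fun r hr => by
        have hpr := hT r hr.1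
        rw [norm_neg, Real.norm_eq_abs, abs_mul, abs_mul, abs_of_nonneg (by positivity : 0 ≤ ρ ^ 2),
          abs_of_nonneg (by positivity : 0 ≤ (1 + r) ^ μ)]
        have := hfM r ⟨hr.1, hr.2.le.trans hτ.2⟩
        have := hr.2.le
        gcongr) τ ⟨hτ.1, le_rfl⟩
    simp only [h.initial_deriv, mul_one, Real.norm_eq_abs] at this
    have h2 : (1 + τ) ^ μ * |g τ| ≤ (1 + s) ^ μ + ρ ^ 2 * ((1 + τ) ^ μ * M) * (τ - s) := by
      have h3 := abs_sub_abs_le_abs_sub ((1 + τ) ^ μ * g τ) ((1 + s) ^ μ)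
      rw [abs_mul, abs_of_nonneg (by positivity : 0 ≤ (1 + τ) ^ μ),
        abs_of_nonneg (by positivity : 0 ≤ (1 + s) ^ μ)] at h3
      linarith
    have hpos : 0 < (1 + τ) ^ μ := by positivity
    rw [← mul_le_mul_iff_right₀ hpos]
    refine h2.trans (le_of_eq ?_)
    rw [Real.rpow_neg hp.le]
    field_simp
  set A := (1 + s) ^ min μ 1 * (1 + t) ^ (1 - min μ 1) with hA
  have hA0 : 0 < A := by positivity
  have hμ1' : 1 - μ ≠ 0 := sub_ne_zero.2 (Ne.symm hμ1)
  -- This is the solution for `ρ = 0`. Its integral of `(1 + r) ^ (-μ)` is governed by the upper end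
  -- for `μ < 1` and by the lower end for `μ > 1`, whence the exponent `min μ 1`; at `μ = 1` it
  -- would be a logarithm.
  have hm : ∀ τ ∈ Set.Icc s t,
      (1 + s) ^ μ * (((1 + τ) ^ (1 - μ) - (1 + s) ^ (1 - μ)) / (1 - μ)) ≤ A / |1 - μ| := by
    intro τ hτ
    have hp := hT τ hτ.1
    rcases lt_or_gt_of_ne hμ1 with hlt | hgt
    · have hpos : 0 < 1 - μ := by linarith
      rw [abs_of_pos hpos, hA, min_eq_left hlt.le, ← mul_div_assoc]
      gcongr
      have h3 : (1 + τ) ^ (1 - μ) ≤ (1 + t) ^ (1 - μ) := by gcongr; exact hτ.2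
      have h4 : 0 ≤ (1 + s) ^ (1 - μ) := by positivity
      linarith
    · have hneg : 1 - μ < 0 := by linarith
      rw [abs_of_neg hneg, hA, min_eq_right hgt.le, ← mul_div_assoc, ← neg_div_neg_eq]
      have hpos : 0 < -(1 - μ) := by linarith
      gcongr
      rw [mul_sub, ← Real.rpow_add hS]
      simp
      positivity
  -- Integrating `hg`, the perturbation contributes `ρ² M (τ - s)² / 2 ≤ M / 2`. Evaluated at the
  -- point of maximum, this is absorbed into the left-hand side.
  have hf : ∀ τ ∈ Set.Icc s t, |f τ| ≤ A / |1 - μ| + M / 2 := by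
    intro τ hτ
    have := image_norm_le_of_norm_deriv_right_le_deriv_boundary' (f := f) (f' := g) (a := s) (b := t)
      (B := fun r => (1 + s) ^ μ * (((1 + r) ^ (1 - μ) - (1 + s) ^ (1 - μ)) / (1 - μ))
        + ρ ^ 2 * M * ((r - s) ^ 2 / 2))
      (B' := fun r => (1 + s) ^ μ * (1 + r) ^ (-μ) + ρ ^ 2 * M * (r - s))
      (fun r hr => (h.deriv r hr.1).continuousAt.continuousWithinAt)
      (fun r hr => (h.deriv r hr.1).hasDerivWithinAt) (by simp [h.initial])
      (fun r hr => ?_) (fun r hr => ?_) (fun r hr => hg r ⟨hr.1, hr.2.le⟩) hτ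
    · refine this.trans (add_le_add (hm τ hτ) ?_)
      have h5 : (ρ * (τ - s)) ^ 2 ≤ 1 := by
        have h6 : ρ * (τ - s) ≤ 1 := le_trans (by gcongr; linarith [hτ.2]) h1
        have h7 : 0 ≤ ρ * (τ - s) := mul_nonneg hρ (by linarith [hτ.1])
        exact pow_le_one₀ h7 h6
      nlinarith
    · refine ContinuousAt.continuousWithinAt ?_
      have hne := (hT r hr.1).ne'
      exact ((((((hid r).rpow_const (p := 1 - μ) (Or.inl hne)).continuousAt).sub
        continuousAt_const).div_const _).const_mul _).add (by fun_prop)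
    · have hne := (hT r hr.1).ne'
      refine HasDerivAt.hasDerivWithinAt ?_
      convert! (((((hid r).rpow_const (p := 1 - μ) (Or.inl hne)).sub_const
        ((1 + s) ^ (1 - μ))).div_const (1 - μ)).const_mul ((1 + s) ^ μ)).add
        (((((hasDerivAt_id r).sub_const s).pow 2).div_const 2).const_mul (ρ ^ 2 * M)) using 1
      rw [show 1 - μ - 1 = -μ by ring]
      field_simp
      simp
      ring
  have hM2 : M ≤ 2 * (A / |1 - μ|) := by
    have := hf x₀ hx₀
    linarith
  refine ⟨((hfM t ⟨ht, le_rfl⟩).trans hM2).trans (le_of_eq (by ring)), ?_⟩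
  have h8 := hg t ⟨ht, le_rfl⟩
  have h9 : (1 + t) * ((1 + s) ^ μ * (1 + t) ^ (-μ)) ≤ A := by
    have e : ∀ a : ℝ, (1 + s) ^ a * (1 + t) ^ (1 - a) = (1 + t) * ((1 + s) / (1 + t)) ^ a := by
      intro a
      rw [Real.div_rpow hS.le hTt.le, Real.rpow_sub hTt, Real.rpow_one]
      ring
    rw [hA, e, Real.rpow_neg hTt.le, ← div_eq_mul_inv, ← Real.div_rpow hS.le hTt.le]
    gcongr ?_ * ?_
    exact Real.rpow_le_rpow_of_exponent_ge (by positivity)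
      ((div_le_one hTt).2 (by linarith)) (min_le_left _ _)
  have h10 : (1 + t) * (ρ ^ 2 * M * (t - s)) ≤ M := by
    have h11 : ρ * (t - s) ≤ 1 := le_trans (by gcongr; linarith) h1
    have h12 : 0 ≤ ρ * (t - s) := mul_nonneg hρ (by linarith)
    calc (1 + t) * (ρ ^ 2 * M * (t - s)) = (ρ * (1 + t)) * (ρ * (t - s)) * M := by ring
      _ ≤ 1 * 1 * M := by gcongr
      _ = M := by ring
  calc (1 + t) * |g t| ≤ (1 + t) * ((1 + s) ^ μ * (1 + t) ^ (-μ) + ρ ^ 2 * M * (t - s)) := by gcongr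
    _ ≤ A + 2 * (A / |1 - μ|) := by rw [mul_add]; linarith
    _ = _ := by ring

end IsDampedMode

/-! ### Bounds of the modes in three frequency zones. -/

/-- Decay of a Fourier multiplier `κ` at time `t` of a problem started at time `s`, where
`S = 1 + s`, `T = 1 + t` and `b` is the order of the multiplier, in the three zones
`ρ ≤ 1 / T`, `1 / T ≤ ρ ≤ 1 / S` and `1 / S ≤ ρ`. -/
structure IsZoneBounded (μ b C S T : ℝ) (κ : ℝ → ℝ) : Prop where
  low : ∀ ρ, 0 ≤ ρ → ρ * T ≤ 1 → |κ ρ| ≤ C * (S ^ min μ 1 * T ^ (1 - min μ 1 - b))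
  middle : ∀ ρ, 0 < ρ → ρ * S ≤ 1 → 1 ≤ ρ * T →
    |κ ρ| ≤ C * (S ^ min μ 1 * ρ ^ (min μ 1 + b - 1) * (ρ * T) ^ (-(μ / 2)))
  high : ∀ ρ, 0 < ρ → 1 ≤ ρ * S → |κ ρ| ≤ C * (S ^ (1 - b) * (S / T) ^ (μ / 2))

-- For `ρ (1 + t) ≤ 1` this is the low-frequency bound. In the middle zone that bound is used up to
-- the time `ρ⁻¹ - 1`, where `ρ (1 + t) = 1`, and its value there feeds the energy decay. For `ρ (1
-- + s) ≥ 1` the energy decay starts at `s` with energy `1`.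
set_option maxHeartbeats 600000 in
theorem IsDampedMode.exists_zone_bounds {μ : ℝ} (hμ : 0 < μ) (hμ1 : μ ≠ 1) :
    ∃ C : ℝ, 0 < C ∧ ∀ s ρ t : ℝ, ∀ f g : ℝ → ℝ, 0 ≤ s → 0 ≤ ρ → s ≤ t →
      IsDampedMode μ s ρ f g →
      (ρ * (1 + t) ≤ 1 → |f t| ≤ C * ((1 + s) ^ min μ 1 * (1 + t) ^ (1 - min μ 1)) ∧
        (1 + t) * |g t| ≤ C * ((1 + s) ^ min μ 1 * (1 + t) ^ (1 - min μ 1))) ∧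
      (ρ * (1 + s) ≤ 1 → 1 ≤ ρ * (1 + t) →
        |ρ * f t| ≤ C * ((1 + s) ^ min μ 1 * ρ ^ min μ 1 * (ρ * (1 + t)) ^ (-(μ / 2))) ∧
        |g t| ≤ C * ((1 + s) ^ min μ 1 * ρ ^ min μ 1 * (ρ * (1 + t)) ^ (-(μ / 2)))) ∧
      (1 ≤ ρ * (1 + s) → |ρ * f t| ≤ C * ((1 + s) / (1 + t)) ^ (μ / 2) ∧
        |g t| ≤ C * ((1 + s) / (1 + t)) ^ (μ / 2)) := by
  set D : ℝ := (2 + μ ^ 2) ^ 2 * Real.exp |μ / 2 * (μ / 2 - 1)| with hD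
  have hD1 : 1 ≤ D := by
    have h1 : 1 ≤ Real.exp |μ / 2 * (μ / 2 - 1)| := Real.one_le_exp (abs_nonneg _)
    have h2 : 1 ≤ (2 + μ ^ 2) ^ 2 := one_le_pow₀ (by nlinarith)
    nlinarith
  set K : ℝ := 1 + 2 / |1 - μ| with hK
  have hK1 : 1 ≤ K := by
    have : 0 ≤ 2 / |1 - μ| := by positivity
    linarith
  have hK0 : 0 ≤ K := by linarith
  have hD0 : 0 < D := by linarith
  have hDK1 : 1 ≤ D * K := one_le_mul_of_one_le_of_one_le hD1 hK1
  have hDK : K ≤ 2 * D * K := by nlinarith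
  have hDsq : D ≤ (2 * D * K) ^ 2 := by
    calc D ≤ D * K := le_mul_of_one_le_right hD0.le hK1
      _ ≤ 2 * D * K := by linarith
      _ ≤ (2 * D * K) ^ 2 := le_self_pow₀ (by linarith) two_ne_zero
  have hsq : ∀ {a r A : ℝ}, 0 ≤ A → a ^ 2 + r ^ 2 ≤ A ^ 2 → |a| ≤ A ∧ |r| ≤ A := by
    intro a r A hA h
    exact ⟨abs_le_of_sq_le_sq (by nlinarith [sq_nonneg r]) hA,
      abs_le_of_sq_le_sq (by nlinarith [sq_nonneg a]) hA⟩
  have hhalf : ∀ {x : ℝ}, 0 < x → (x ^ (μ / 2)) ^ 2 = x ^ μ := by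
    intro x hx
    rw [← Real.rpow_natCast, ← Real.rpow_mul hx.le]
    norm_num
  -- In the middle zone the energy at the switching time is at most `2 (K A) ^ 2`, and `D * 2 (K A)
  -- ^ 2 ≤ (2 D K A) ^ 2`; the other two zones need less.
  refine ⟨2 * D * K, by positivity, fun s ρ t f g hs hρ ht h => ⟨fun h1 => ?_, fun h1 h2 => ?_,
    fun h1 => ?_⟩⟩
  · obtain ⟨h2, h3⟩ := h.low_frequency_bound hμ.le hμ1 hs hρ ht h1
    have hA : 0 ≤ (1 + s) ^ min μ 1 * (1 + t) ^ (1 - min μ 1) := by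
      have : 0 ≤ 1 + s := by linarith
      have : 0 ≤ 1 + t := by linarith
      positivity
    refine ⟨h2.trans ?_, h3.trans ?_⟩ <;> gcongr
    linarith
  · have hρ' : 0 < ρ := by
      rcases hρ.eq_or_lt with rfl | h'
      · simp at h2
        linarith
      · exact h'
    have hS : 0 < 1 + s := by linarith
    have hT : 0 < 1 + t := by linarith
    have hts : s ≤ ρ⁻¹ - 1 := by
      rw [le_sub_iff_add_le, add_comm]
      exact (le_inv_comm₀ hS hρ').2 (by rw [inv_eq_one_div, le_div_iff₀ hS]; exact h1)
    have htt : ρ⁻¹ - 1 ≤ t := by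
      rw [sub_le_iff_le_add, add_comm]
      exact (inv_le_iff_one_le_mul₀ hρ').2 (by rwa [mul_comm])
    have hT0 : 1 + (ρ⁻¹ - 1) = ρ⁻¹ := by ring
    have hT0' : ρ * (1 + (ρ⁻¹ - 1)) = 1 := by rw [hT0]; field_simp
    have hd := h.energy_decay (μ := μ) hs hρ' hts htt hT0'.ge
    obtain ⟨h3, h4⟩ := h.low_frequency_bound hμ.le hμ1 hs hρ hts hT0'.le
    rw [hT0] at hd h3 h4
    set A := (1 + s) ^ min μ 1 * ρ ^ min μ 1 with hA
    have hA0 : 0 < A := by positivity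
    have e1 : (1 + s) ^ min μ 1 * ρ⁻¹ ^ (1 - min μ 1) = A / ρ := by
      rw [Real.inv_rpow hρ, Real.rpow_sub hρ', Real.rpow_one, hA]
      field_simp
    rw [e1] at h3 h4
    have h5 : g (ρ⁻¹ - 1) ^ 2 + ρ ^ 2 * f (ρ⁻¹ - 1) ^ 2 ≤ 2 * (K * A) ^ 2 := by
      have h6 : |g (ρ⁻¹ - 1)| ≤ K * A := by
        have : ρ * (ρ⁻¹ * |g (ρ⁻¹ - 1)|) ≤ ρ * (K * (A / ρ)) := by gcongr
        calc _ = ρ * (ρ⁻¹ * |g (ρ⁻¹ - 1)|) := by field_simp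
          _ ≤ _ := this
          _ = _ := by field_simp
      have h7 : |ρ * f (ρ⁻¹ - 1)| ≤ K * A := by
        rw [abs_mul, abs_of_pos hρ']
        calc _ ≤ ρ * (2 / |1 - μ| * (A / ρ)) := by gcongr
          _ = 2 / |1 - μ| * A := by field_simp
          _ ≤ K * A := by gcongr; linarith
      have h8 := sq_le_sq.2 (h6.trans (le_abs_self _))
      have h9 := sq_le_sq.2 (h7.trans (le_abs_self _))
      nlinarith
    have h6 : g t ^ 2 + (ρ * f t) ^ 2 ≤ (2 * D * K * (A * (ρ * (1 + t)) ^ (-(μ / 2)))) ^ 2 := by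
      have h7 : (1 + t) ^ μ * (g t ^ 2 + ρ ^ 2 * f t ^ 2) ≤ D * (ρ⁻¹ ^ μ * (2 * (K * A) ^ 2)) :=
        hd.trans (by gcongr)
      have h8 : ((ρ * (1 + t)) ^ (-(μ / 2))) ^ 2 = ρ⁻¹ ^ μ / (1 + t) ^ μ := by
        rw [Real.rpow_neg (by positivity), inv_pow, hhalf (by positivity),
          Real.mul_rpow hρ hT.le, Real.inv_rpow hρ]
        field_simp
      rw [← mul_pow] at h7
      rw [mul_pow _ (A * _), mul_pow A, h8]
      have hpos : 0 < (1 + t) ^ μ := by positivity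
      rw [← mul_le_mul_iff_right₀ hpos]
      calc (1 + t) ^ μ * (g t ^ 2 + (ρ * f t) ^ 2)
          ≤ D * (ρ⁻¹ ^ μ * (2 * (K * A) ^ 2)) := h7
        _ = (2 * D) * (K ^ 2 * A ^ 2 * ρ⁻¹ ^ μ) := by ring
        _ ≤ (2 * D) ^ 2 * (K ^ 2 * A ^ 2 * ρ⁻¹ ^ μ) := by
            gcongr
            nlinarith
        _ = _ := by field_simp
    obtain ⟨h7, h8⟩ := hsq (by positivity) h6
    exact ⟨h8, h7⟩
  · have hS : 0 < 1 + s := by linarith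
    have hT : 0 < 1 + t := by linarith
    have hρ' : 0 < ρ := by
      rcases hρ.eq_or_lt with rfl | h'
      · simp at h1
        linarith
      · exact h'
    have hd := h.energy_decay (μ := μ) hs hρ' le_rfl ht h1
    rw [h.initial, h.initial_deriv] at hd
    have h6 : g t ^ 2 + (ρ * f t) ^ 2 ≤ (2 * D * K * ((1 + s) / (1 + t)) ^ (μ / 2)) ^ 2 := by
      rw [mul_pow _ (_ ^ _), hhalf (by positivity), Real.div_rpow hS.le hT.le]
      have hpos : 0 < (1 + t) ^ μ := by positivity
      rw [← mul_le_mul_iff_right₀ hpos]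
      calc (1 + t) ^ μ * (g t ^ 2 + (ρ * f t) ^ 2)
          ≤ D * (1 + s) ^ μ := by
            rw [mul_pow]
            simpa [hD, abs_mul] using hd
        _ ≤ (2 * D * K) ^ 2 * (1 + s) ^ μ := by
            gcongr
        _ = _ := by field_simp
    obtain ⟨h7, h8⟩ := hsq (by positivity) h6
    exact ⟨h8, h7⟩

/-- The multiplier `ρ ^ b K(t, s, ρ)` of the solution. -/
theorem IsDampedMode.exists_isZoneBounded {μ b : ℝ} (hμ : 0 < μ) (hμ1 : μ ≠ 1) (hb : 0 ≤ b)
    (hb1 : b ≤ 1) :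
    ∃ C : ℝ, 0 < C ∧ ∀ s t : ℝ, ∀ f g : ℝ → ℝ → ℝ, 0 ≤ s → s ≤ t →
      (∀ ρ, IsDampedMode μ s ρ (f ρ) (g ρ)) →
      IsZoneBounded μ b C (1 + s) (1 + t) fun ρ => ρ ^ b * f ρ t := by
  obtain ⟨C, hC, H⟩ := exists_zone_bounds hμ hμ1
  refine ⟨C, hC, fun s t f g hs ht h => ⟨fun ρ hρ h1 => ?_, fun ρ hρ h1 h2 => ?_,
    fun ρ hρ h1 => ?_⟩⟩
  · have hS : 0 < 1 + s := by linarith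
    have hT : 0 < 1 + t := by linarith
    have h2 := ((H s ρ t _ _ hs hρ ht (h ρ)).1 h1).1
    have h3 : ρ ^ b ≤ (1 + t) ^ (-b) := by
      rw [Real.rpow_neg hT.le, ← Real.inv_rpow hT.le]
      gcongr
      rw [← one_div, le_div_iff₀ hT]
      exact h1
    rw [abs_mul, abs_of_nonneg (by positivity)]
    calc _ ≤ (1 + t) ^ (-b) * (C * ((1 + s) ^ min μ 1 * (1 + t) ^ (1 - min μ 1))) := by gcongr
      _ = _ := by
        rw [sub_eq_add_neg _ b, Real.rpow_add hT]
        ring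
  · have h3 := ((H s ρ t _ _ hs hρ.le ht (h ρ)).2.1 h1 h2).1
    rw [abs_mul, abs_of_pos hρ] at h3
    rw [abs_mul, abs_of_nonneg (by positivity)]
    calc ρ ^ b * |f ρ t| = ρ ^ (b - 1) * (ρ * |f ρ t|) := by
          rw [Real.rpow_sub_one hρ.ne']
          field_simp
      _ ≤ ρ ^ (b - 1) * (C * ((1 + s) ^ min μ 1 * ρ ^ min μ 1 * (ρ * (1 + t)) ^ (-(μ / 2)))) := by
          gcongr
      _ = _ := by
          rw [add_sub_assoc, Real.rpow_add hρ]
          ring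
  · have hS : 0 < 1 + s := by linarith
    have hT : 0 < 1 + t := by linarith
    have h3 := ((H s ρ t _ _ hs hρ.le ht (h ρ)).2.2 h1).1
    rw [abs_mul, abs_of_pos hρ] at h3
    rw [abs_mul, abs_of_nonneg (by positivity)]
    have h4 : ρ ^ (b - 1) ≤ (1 + s) ^ (1 - b) := by
      rw [← neg_sub 1 b, Real.rpow_neg hρ.le, ← Real.inv_rpow hρ.le]
      have : ρ⁻¹ ≤ 1 + s := (inv_le_iff_one_le_mul₀ hρ).2 (by rwa [mul_comm])
      have : 0 ≤ 1 - b := by linarith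
      gcongr
    calc ρ ^ b * |f ρ t| = ρ ^ (b - 1) * (ρ * |f ρ t|) := by
          rw [Real.rpow_sub_one hρ.ne']
          field_simp
      _ ≤ (1 + s) ^ (1 - b) * (C * ((1 + s) / (1 + t)) ^ (μ / 2)) := by gcongr
      _ = _ := by ring

/-- The multiplier `∂ₜK(t, s, ρ)` of the time derivative of the solution. -/
theorem IsDampedMode.exists_isZoneBounded_deriv {μ : ℝ} (hμ : 0 < μ) (hμ1 : μ ≠ 1) :
    ∃ C : ℝ, 0 < C ∧ ∀ s t : ℝ, ∀ f g : ℝ → ℝ → ℝ, 0 ≤ s → s ≤ t →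
      (∀ ρ, IsDampedMode μ s ρ (f ρ) (g ρ)) →
      IsZoneBounded μ 1 C (1 + s) (1 + t) fun ρ => g ρ t := by
  obtain ⟨C, hC, H⟩ := exists_zone_bounds hμ hμ1
  refine ⟨C, hC, fun s t f g hs ht h => ⟨fun ρ hρ h1 => ?_, fun ρ hρ h1 h2 => ?_,
    fun ρ hρ h1 => ?_⟩⟩
  · have hT : 0 < 1 + t := by linarith
    have h2 := ((H s ρ t _ _ hs hρ ht (h ρ)).1 h1).2
    rw [← mul_le_mul_iff_right₀ hT]
    refine h2.trans (le_of_eq ?_)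
    rw [Real.rpow_sub_one hT.ne']
    field_simp
  · simpa using ((H s ρ t _ _ hs hρ.le ht (h ρ)).2.1 h1 h2).2
  · simpa using ((H s ρ t _ _ hs hρ.le ht (h ρ)).2.2 h1).2

/-! ### Integrals of powers of the symbol over balls and annuli. -/

/-- The symbol `|ξ| ^ σ` of `(-Δ) ^ (σ / 2)`. -/
noncomputable def freq {n : ℕ} (σ : ℝ) (ξ : EuclideanSpace ℝ (Fin n)) : ℝ :=
  (2 * Real.pi * ‖ξ‖) ^ σ

theorem freq_nonneg {n : ℕ} (σ : ℝ) (ξ : EuclideanSpace ℝ (Fin n)) : 0 ≤ freq σ ξ := by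
  unfold freq
  positivity

theorem measurable_freq {n : ℕ} {σ : ℝ} :
    Measurable (freq σ : EuclideanSpace ℝ (Fin n) → ℝ) := by
  unfold freq
  fun_prop

/-- The size of `∫ ρ ^ (θ - 1) dρ` over `1 / T ≤ ρ ≤ 1 / S`. -/
noncomputable def annulusWeight (θ S T : ℝ) : ℝ :=
  if θ < 0 then T ^ (-θ) else if θ = 0 then Real.log (T / S) else S ^ (-θ)

theorem annulusWeight_nonneg {θ S T : ℝ} (hS : 0 < S) (hST : S ≤ T) :
    0 ≤ annulusWeight θ S T := by
  have hT : 0 < T := hS.trans_le hST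
  unfold annulusWeight
  split_ifs
  · positivity
  · exact Real.log_nonneg ((one_le_div hS).2 hST)
  · positivity

theorem rpow_mul_le_one_iff {σ S r : ℝ} (hσ : 0 < σ) (hS : 0 < S) (hr : 0 ≤ r) :
    (2 * Real.pi * r) ^ σ * S ≤ 1 ↔ r ≤ S ^ (-(1 / σ)) / (2 * Real.pi) := by
  have h1 : S⁻¹ = (S ^ (-(1 / σ))) ^ σ := by
    rw [← Real.rpow_mul hS.le, ← Real.rpow_neg_one]
    congr 1
    field_simp
  rw [← le_div_iff₀ hS, one_div, h1, Real.rpow_le_rpow_iff (by positivity) (by positivity) hσ,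
    le_div_iff₀ (by positivity), mul_comm]

theorem one_le_rpow_mul_iff {σ S r : ℝ} (hσ : 0 < σ) (hS : 0 < S) (hr : 0 ≤ r) :
    1 ≤ (2 * Real.pi * r) ^ σ * S ↔ S ^ (-(1 / σ)) / (2 * Real.pi) ≤ r := by
  have h1 : S⁻¹ = (S ^ (-(1 / σ))) ^ σ := by
    rw [← Real.rpow_mul hS.le, ← Real.rpow_neg_one]
    congr 1
    field_simp
  rw [← div_le_iff₀ hS, one_div, h1, Real.rpow_le_rpow_iff (by positivity) (by positivity) hσ,
    div_le_iff₀ (by positivity), mul_comm r]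

/-- Under `ρ = (2 π y) ^ σ` the endpoints become `1 / T` and `1 / S`, and `y ^ (σ θ - 1) dy` becomes
a multiple of `ρ ^ (θ - 1) dρ`. -/
theorem exists_integral_rpow_le {σ : ℝ} (hσ : 0 < σ) (θ : ℝ) :
    ∃ C : ℝ, 0 < C ∧ ∀ S T : ℝ, 0 < S → S ≤ T →
      ∫ y in (T ^ (-(1 / σ)) / (2 * Real.pi))..(S ^ (-(1 / σ)) / (2 * Real.pi)), y ^ (σ * θ - 1)
        ≤ C * annulusWeight θ S T := by
  have hpow : ∀ x : ℝ, 0 < x → (x ^ (-(1 / σ)) / (2 * Real.pi)) ^ (σ * θ)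
      = (2 * Real.pi) ^ (-(σ * θ)) * x ^ (-θ) := by
    intro x hx
    rw [Real.div_rpow (by positivity) (by positivity), ← Real.rpow_mul hx.le,
      Real.rpow_neg (by positivity : (0 : ℝ) ≤ 2 * Real.pi), div_eq_inv_mul]
    congr 2
    field_simp
  have hint : ∀ S T : ℝ, 0 < S → 0 < T → θ ≠ 0 →
      ∫ y in (T ^ (-(1 / σ)) / (2 * Real.pi))..(S ^ (-(1 / σ)) / (2 * Real.pi)), y ^ (σ * θ - 1)
        = (2 * Real.pi) ^ (-(σ * θ)) * (S ^ (-θ) - T ^ (-θ)) / (σ * θ) := by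
    intro S T hS hT hθ
    have h0 : (0 : ℝ) ∉ Set.uIcc (T ^ (-(1 / σ)) / (2 * Real.pi)) (S ^ (-(1 / σ)) / (2 * Real.pi)) :=
      Set.notMem_uIcc_of_lt (by positivity) (by positivity)
    rw [integral_rpow (Or.inr ⟨fun h => (mul_ne_zero hσ.ne' hθ) (by linarith), h0⟩)]
    rw [sub_add_cancel, hpow S hS, hpow T hT]
    ring
  rcases lt_trichotomy θ 0 with hθ | hθ | hθ
  · refine ⟨(2 * Real.pi) ^ (-(σ * θ)) / (σ * -θ), ?_, fun S T hS hST => ?_⟩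
    · have : 0 < -θ := by linarith
      positivity
    · have hT : 0 < T := hS.trans_le hST
      have h1 : 0 < -θ := by linarith
      rw [hint S T hS hT hθ.ne, annulusWeight, if_pos hθ]
      have h2 : 0 ≤ S ^ (-θ) := by positivity
      calc _ = (2 * Real.pi) ^ (-(σ * θ)) * (T ^ (-θ) - S ^ (-θ)) / (σ * -θ) := by
            rw [mul_neg, div_neg]
            ring
        _ ≤ (2 * Real.pi) ^ (-(σ * θ)) * T ^ (-θ) / (σ * -θ) := by
            gcongr
            linarith
        _ = _ := by ring
  · subst hθ
    refine ⟨σ⁻¹, by positivity, fun S T hS hST => ?_⟩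
    have hT : 0 < T := hS.trans_le hST
    simp only [mul_zero, zero_sub, Real.rpow_neg_one, annulusWeight, lt_irrefl, if_false, if_true]
    rw [integral_inv_of_pos (by positivity) (by positivity)]
    rw [div_div_div_cancel_right₀ (by positivity), Real.log_div (by positivity) (by positivity),
      Real.log_rpow hS, Real.log_rpow hT, Real.log_div hT.ne' hS.ne']
    apply le_of_eq
    ring
  · refine ⟨(2 * Real.pi) ^ (-(σ * θ)) / (σ * θ), by positivity, fun S T hS hST => ?_⟩
    have hT : 0 < T := hS.trans_le hST
    rw [hint S T hS hT hθ.ne', annulusWeight, if_neg hθ.not_gt, if_neg hθ.ne']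
    have h2 : 0 ≤ T ^ (-θ) := by positivity
    calc _ ≤ (2 * Real.pi) ^ (-(σ * θ)) * S ^ (-θ) / (σ * θ) := by
          gcongr
          linarith
      _ = _ := by ring

/-- Polar coordinates: `r ^ (n - 1) dr` is a multiple of `ρ ^ (n / σ - 1) dρ`, so the exponent `θ -
n / σ` leaves `ρ ^ (θ - 1) dρ`. -/
theorem exists_lintegral_annulus_le {n : ℕ} (hn : 1 ≤ n) {σ : ℝ} (hσ : 0 < σ) (θ : ℝ) :
    ∃ C : ℝ, 0 < C ∧ ∀ S T : ℝ, 0 < S → S ≤ T →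
      ∫⁻ ξ : EuclideanSpace ℝ (Fin n) in {ξ | 1 ≤ freq σ ξ * T ∧ freq σ ξ * S ≤ 1},
        ENNReal.ofReal (freq σ ξ ^ (θ - n / σ)) ≤ ENNReal.ofReal (C * annulusWeight θ S T) := by
  obtain ⟨C, hC, H⟩ := exists_integral_rpow_le hσ θ
  have : Nonempty (Fin n) := ⟨⟨0, hn⟩⟩
  set V : ℝ := (volume : Measure (EuclideanSpace ℝ (Fin n))).real (Metric.ball 0 1) with hV
  have hV0 : 0 ≤ V := measureReal_nonneg
  refine ⟨n * V * ((2 * Real.pi) ^ (σ * θ - n) * C) + 1, by positivity, fun S T hS hST => ?_⟩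
  have hT : 0 < T := hS.trans_le hST
  set y₀ := T ^ (-(1 / σ)) / (2 * Real.pi) with hy₀
  set y₁ := S ^ (-(1 / σ)) / (2 * Real.pi) with hy₁
  have hy₀0 : 0 < y₀ := by positivity
  have hy : y₀ ≤ y₁ := by
    rw [hy₀, hy₁]
    gcongr ?_ / _
    exact Real.rpow_le_rpow_of_nonpos hS hST (by simp; positivity)
  let F : ℝ → ℝ := (Set.Icc y₀ y₁).indicator fun r => ((2 * Real.pi * r) ^ σ) ^ (θ - n / σ)
  have hF0 : ∀ r, 0 ≤ F r := by
    intro r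
    refine Set.indicator_nonneg (fun r hr => ?_) r
    have := hy₀0.trans_le hr.1
    positivity
  have hset : {ξ : EuclideanSpace ℝ (Fin n) | 1 ≤ freq σ ξ * T ∧ freq σ ξ * S ≤ 1}
      = (fun ξ => ‖ξ‖) ⁻¹' Set.Icc y₀ y₁ := by
    ext ξ
    simp only [Set.mem_ofPred_eq, Set.mem_preimage, Set.mem_Icc, freq]
    rw [rpow_mul_le_one_iff hσ hS (norm_nonneg _), one_le_rpow_mul_iff hσ hT (norm_nonneg _)]
  have hmeas : MeasurableSet ((fun ξ : EuclideanSpace ℝ (Fin n) => ‖ξ‖) ⁻¹' Set.Icc y₀ y₁) :=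
    measurable_norm measurableSet_Icc
  have h1 : ∫⁻ ξ : EuclideanSpace ℝ (Fin n) in {ξ | 1 ≤ freq σ ξ * T ∧ freq σ ξ * S ≤ 1},
      ENNReal.ofReal (freq σ ξ ^ (θ - n / σ))
      = ∫⁻ ξ : EuclideanSpace ℝ (Fin n), ENNReal.ofReal (F ‖ξ‖) := by
    rw [hset, ← lintegral_indicator hmeas]
    congr 1
    funext ξ
    by_cases h : ‖ξ‖ ∈ Set.Icc y₀ y₁
    · rw [Set.indicator_of_mem (by exact h)]
      simp only [F, Set.indicator_of_mem h, freq]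
    · rw [Set.indicator_of_notMem (by exact h)]
      simp only [F, Set.indicator_of_notMem h, ENNReal.ofReal_zero]
  have hpoint : ∀ y ∈ Set.Icc y₀ y₁, y ^ (n - 1) * ((2 * Real.pi * y) ^ σ) ^ (θ - n / σ)
      = (2 * Real.pi) ^ (σ * θ - n) * y ^ (σ * θ - 1) := by
    intro y hy
    have hy0 : 0 < y := hy₀0.trans_le hy.1
    have e1 : σ * (θ - n / σ) = σ * θ - n := by field_simp
    rw [← Real.rpow_mul (by positivity), e1, Real.mul_rpow (by positivity) hy0.le,
      ← Real.rpow_natCast y (n - 1), mul_left_comm, ← Real.rpow_add hy0]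
    congr 2
    push_cast [Nat.cast_sub hn]
    ring
  have hfun : (fun y : ℝ => y ^ (Module.finrank ℝ (EuclideanSpace ℝ (Fin n)) - 1) • F y)
      = (Set.Icc y₀ y₁).indicator fun y => (2 * Real.pi) ^ (σ * θ - n) * y ^ (σ * θ - 1) := by
    funext y
    rw [finrank_euclideanSpace_fin]
    by_cases h : y ∈ Set.Icc y₀ y₁
    · simp only [F, Set.indicator_of_mem h, smul_eq_mul]
      exact hpoint y h
    · simp only [F, Set.indicator_of_notMem h, smul_zero]
  have hcont : ContinuousOn (fun y : ℝ => (2 * Real.pi) ^ (σ * θ - n) * y ^ (σ * θ - 1))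
      (Set.Icc y₀ y₁) := by
    refine continuousOn_const.mul (continuousOn_id.rpow_const fun y hy => Or.inl ?_)
    exact (hy₀0.trans_le hy.1).ne'
  have hint : Integrable (fun ξ : EuclideanSpace ℝ (Fin n) => F ‖ξ‖) := by
    rw [integrable_fun_norm_addHaar volume, hfun]
    exact ((hcont.integrableOn_compact isCompact_Icc).integrable_indicator
      measurableSet_Icc).integrableOn
  have hsub : Set.Icc y₀ y₁ ⊆ Set.Ioi 0 := fun y hy => hy₀0.trans_le hy.1
  rw [h1, ← ofReal_integral_eq_lintegral_ofReal hint (ae_of_all _ fun ξ => hF0 _)]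
  refine ENNReal.ofReal_le_ofReal ?_
  rw [integral_fun_norm_addHaar volume, hfun, setIntegral_indicator measurableSet_Icc,
    Set.inter_eq_self_of_subset_right hsub, integral_const_mul,
    integral_Icc_eq_integral_Ioc, ← intervalIntegral.integral_of_le hy, finrank_euclideanSpace_fin]
  have hL := annulusWeight_nonneg (θ := θ) hS hST
  calc n • V • ((2 * Real.pi) ^ (σ * θ - n) * ∫ y in y₀..y₁, y ^ (σ * θ - 1))
      = n * V * ((2 * Real.pi) ^ (σ * θ - n) * ∫ y in y₀..y₁, y ^ (σ * θ - 1)) := by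
        simp only [nsmul_eq_mul, smul_eq_mul]
        ring
    _ ≤ n * V * ((2 * Real.pi) ^ (σ * θ - n) * (C * annulusWeight θ S T)) := by
        gcongr
        exact H S T hS hST
    _ ≤ _ := by
        rw [add_mul, one_mul]
        refine le_add_of_le_of_nonneg (le_of_eq ?_) hL
        ring

theorem exists_volume_freq_le (n : ℕ) {σ : ℝ} (hσ : 0 < σ) :
    ∃ C : ℝ, 0 < C ∧ ∀ T : ℝ, 0 < T →
      volume {ξ : EuclideanSpace ℝ (Fin n) | freq σ ξ * T ≤ 1} ≤
        ENNReal.ofReal (C * T ^ (-(n / σ))) := by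
  set V : ℝ := (volume : Measure (EuclideanSpace ℝ (Fin n))).real (Metric.ball 0 1) with hV
  have hV0 : 0 ≤ V := measureReal_nonneg
  refine ⟨V / (2 * Real.pi) ^ n + 1, by positivity, fun T hT => ?_⟩
  have hset : {ξ : EuclideanSpace ℝ (Fin n) | freq σ ξ * T ≤ 1}
      = Metric.closedBall 0 (T ^ (-(1 / σ)) / (2 * Real.pi)) := by
    ext ξ
    simp only [Set.mem_ofPred_eq, freq, mem_closedBall_zero_iff]
    exact rpow_mul_le_one_iff hσ hT (norm_nonneg _)
  have e1 : (T ^ (-(1 / σ))) ^ n = T ^ (-(n / σ)) := by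
    rw [← Real.rpow_natCast, ← Real.rpow_mul hT.le]
    congr 1
    ring
  rw [hset, Measure.addHaar_closedBall _ _ (by positivity), finrank_euclideanSpace_fin, div_pow, e1,
    ← ofReal_measureReal (measure_ball_lt_top.ne), ← ENNReal.ofReal_mul (by positivity)]
  refine ENNReal.ofReal_le_ofReal ?_
  rw [← hV, add_mul, one_mul]
  refine le_add_of_le_of_nonneg (le_of_eq (by ring)) (by positivity)

/-- Lets the contribution of the ball `ρ T ≤ 1` be absorbed into that of the annulus. The gap `2 S ≤
T` matters for `θ = 0`, where the weight `log (T / S)` vanishes as `T` approaches `S`. -/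
theorem exists_rpow_neg_le_annulusWeight (θ : ℝ) :
    ∃ c : ℝ, 0 < c ∧ ∀ S T : ℝ, 0 < S → 2 * S ≤ T → T ^ (-θ) ≤ c * annulusWeight θ S T := by
  have hl : 0 < Real.log 2 := Real.log_pos one_lt_two
  refine ⟨1 + (Real.log 2)⁻¹, by positivity, fun S T hS hST => ?_⟩
  have hT : 0 < T := by linarith
  have hw : T ^ (-θ) ≤ annulusWeight θ S T ∨ T ^ (-θ) ≤ (Real.log 2)⁻¹ * annulusWeight θ S T := by
    unfold annulusWeight
    split_ifs with h1 h2
    · exact Or.inl le_rfl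
    · right
      rw [h2, neg_zero, Real.rpow_zero, inv_mul_eq_div, one_le_div hl]
      exact Real.log_le_log two_pos ((le_div_iff₀ hS).2 hST)
    · left
      exact Real.rpow_le_rpow_of_nonpos hS (by linarith) (by push Not at h1; linarith)
  have hL := annulusWeight_nonneg (θ := θ) hS (by linarith : S ≤ T)
  have hL' : 0 ≤ (Real.log 2)⁻¹ * annulusWeight θ S T := by positivity
  rw [add_mul, one_mul]
  rcases hw with h | h <;> linarith

/-! ### `L²` norms of zone-bounded multipliers. -/

theorem rpow_le_of_mem_Icc {S x e : ℝ} (hS : 0 < S) (h1 : S ≤ x) (h2 : x ≤ 2 * S) :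
    x ^ e ≤ 2 ^ |e| * S ^ e := by
  have hx : 0 < x := by linarith
  rcases le_total 0 e with he | he
  · rw [abs_of_nonneg he, ← Real.mul_rpow two_pos.le hS.le]
    gcongr
  · calc x ^ e ≤ S ^ e := Real.rpow_le_rpow_of_nonpos hS h1 he
      _ ≤ 2 ^ |e| * S ^ e := le_mul_of_one_le_left (by positivity)
        (Real.one_le_rpow one_le_two (abs_nonneg _))

/-- The common shape of the three zone bounds is `C S ^ m T ^ (-μ / 2) x ^ e` with `m = min μ 1`, `e
= μ / 2 + 1 - m - b`; the high zone has `x = S`, the low one `x = T`, the middle one `x = 1 / ρ`. -/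
theorem IsZoneBounded.high' {μ b C S T : ℝ} {κ : ℝ → ℝ} (h : IsZoneBounded μ b C S T κ)
    (hS : 0 < S) (hT : 0 < T) {ρ : ℝ} (hρ : 0 < ρ) (h1 : 1 ≤ ρ * S) :
    |κ ρ| ≤ C * (S ^ min μ 1 * T ^ (-(μ / 2)) * S ^ (μ / 2 + 1 - min μ 1 - b)) := by
  refine (h.high ρ hρ h1).trans (le_of_eq ?_)
  rw [Real.div_rpow hS.le hT.le, Real.rpow_neg hT.le, mul_right_comm, ← Real.rpow_add hS,
    show min μ 1 + (μ / 2 + 1 - min μ 1 - b) = (1 - b) + μ / 2 by ring, Real.rpow_add hS]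
  ring

/-- As long as `t` is comparable to `s`, no decay is involved. -/
theorem IsZoneBounded.abs_le_of_le_two_mul {μ b C S T : ℝ} {κ : ℝ → ℝ}
    (h : IsZoneBounded μ b C S T κ) (hC : 0 ≤ C) (hS : 0 < S) (hST : S ≤ T) (hT2 : T ≤ 2 * S)
    {ρ : ℝ} (hρ : 0 ≤ ρ) :
    |κ ρ| ≤ C * 2 ^ |μ / 2 + 1 - min μ 1 - b| *
      (S ^ min μ 1 * T ^ (-(μ / 2)) * S ^ (μ / 2 + 1 - min μ 1 - b)) := by
  have hT : 0 < T := hS.trans_le hST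
  set e := μ / 2 + 1 - min μ 1 - b with he
  -- In each zone `x` lies in `[S, T] ⊆ [S, 2 S]`, so `x ^ e` is comparable to `S ^ e`.
  have hx : ∀ x, S ≤ x → x ≤ 2 * S →
      C * (S ^ min μ 1 * T ^ (-(μ / 2)) * x ^ e) ≤
        C * 2 ^ |e| * (S ^ min μ 1 * T ^ (-(μ / 2)) * S ^ e) := by
    intro x h1 h2
    calc _ ≤ C * (S ^ min μ 1 * T ^ (-(μ / 2)) * (2 ^ |e| * S ^ e)) := by
          gcongr
          exact rpow_le_of_mem_Icc hS h1 h2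
      _ = _ := by ring
  by_cases h1 : ρ * T ≤ 1
  · refine (h.low ρ hρ h1).trans (le_trans (le_of_eq ?_) (hx T hST hT2))
    rw [mul_assoc (S ^ _), ← Real.rpow_add hT]
    congr 3
    rw [he]
    ring
  · push Not at h1
    have hρ' : 0 < ρ := by
      rcases hρ.eq_or_lt with rfl | h'
      · simp at h1
        linarith
      · exact h'
    by_cases h2 : ρ * S ≤ 1
    · refine (h.middle ρ hρ' h2 h1.le).trans (le_trans (le_of_eq ?_) (hx ρ⁻¹ ?_ ?_))
      · rw [Real.mul_rpow hρ hT.le, Real.inv_rpow hρ, ← Real.rpow_neg hρ,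
          show -e = (min μ 1 + b - 1) + -(μ / 2) by rw [he]; ring, Real.rpow_add hρ']
        ring
      · rwa [← one_div, le_div_iff₀ hρ', mul_comm]
      · refine le_trans ?_ hT2
        rw [inv_le_iff_one_le_mul₀ hρ', mul_comm]
        exact h1.le
    · push Not at h2
      exact (h.high' hS hT hρ' h2.le).trans (hx S le_rfl (by linarith))

/-- Let `P = S ^ m T ^ (-μ / 2)`. On the ball `ρ T ≤ 1`, of volume at most a multiple of `T ^ (-n /
σ)`, the square is at most a multiple of `P² T ^ (2 e)`, which gives `P² T ^ (-θ)`. On the annulus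
it is at most a multiple of `P² ρ ^ (-2 e) = P² ρ ^ (θ - n / σ)`. -/
theorem IsZoneBounded.exists_lintegral_sq_le {n : ℕ} (hn : 1 ≤ n) {σ μ b C₀ : ℝ} (hσ : 0 < σ) :
    ∃ C : ℝ, 0 < C ∧ ∀ S T : ℝ, ∀ κ : ℝ → ℝ, 0 < S → 2 * S ≤ T → IsZoneBounded μ b C₀ S T κ →
      ∫⁻ ξ : EuclideanSpace ℝ (Fin n) in {ξ | freq σ ξ * S ≤ 1}, ENNReal.ofReal (κ (freq σ ξ) ^ 2) ≤
        ENNReal.ofReal (C * ((S ^ min μ 1 * T ^ (-(μ / 2))) ^ 2 *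
          annulusWeight (n / σ - 2 * (μ / 2 + 1 - min μ 1 - b)) S T)) := by
  set e := μ / 2 + 1 - min μ 1 - b with he
  set θ := n / σ - 2 * e with hθ
  obtain ⟨C₁, hC₁, H₁⟩ := exists_lintegral_annulus_le hn hσ θ
  obtain ⟨C₂, hC₂, H₂⟩ := exists_volume_freq_le n hσ
  obtain ⟨C₃, hC₃, H₃⟩ := exists_rpow_neg_le_annulusWeight θ
  refine ⟨C₀ ^ 2 * C₂ * C₃ + C₀ ^ 2 * C₁ + 1, by positivity, fun S T κ hS hST h => ?_⟩
  have hST' : S ≤ T := by linarith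
  have hT : 0 < T := by linarith
  have hL := annulusWeight_nonneg (θ := θ) hS hST'
  set L := annulusWeight θ S T with hLdef
  have hfm : Measurable (freq σ : EuclideanSpace ℝ (Fin n) → ℝ) := measurable_freq
  set Z₁ : Set (EuclideanSpace ℝ (Fin n)) := {ξ | freq σ ξ * T ≤ 1} with hZ₁
  set Z₂ : Set (EuclideanSpace ℝ (Fin n)) := {ξ | 1 ≤ freq σ ξ * T ∧ freq σ ξ * S ≤ 1} with hZ₂
  have hZ₁m : MeasurableSet Z₁ := measurableSet_le (hfm.mul_const T) measurable_const
  have hZ₂m : MeasurableSet Z₂ := (measurableSet_le measurable_const (hfm.mul_const T)).inter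
    (measurableSet_le (hfm.mul_const S) measurable_const)
  have hsub : {ξ : EuclideanSpace ℝ (Fin n) | freq σ ξ * S ≤ 1} ⊆ Z₁ ∪ Z₂ := by
    intro ξ hξ
    rcases le_total (freq σ ξ * T) 1 with h1 | h1
    · exact Or.inl h1
    · exact Or.inr ⟨h1, hξ⟩
  have hT2 : (T ^ (-(μ / 2))) ^ 2 = T ^ (-μ) := by
    rw [← Real.rpow_natCast, ← Real.rpow_mul hT.le]
    congr 1
    push_cast
    ring
  have b₁ : ∫⁻ ξ in Z₁, ENNReal.ofReal (κ (freq σ ξ) ^ 2) ≤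
      ENNReal.ofReal (C₀ ^ 2 * C₂ * C₃ * ((S ^ min μ 1 * T ^ (-(μ / 2))) ^ 2 * L)) := by
    calc _ ≤ ∫⁻ ξ in Z₁, ENNReal.ofReal ((C₀ * (S ^ min μ 1 * T ^ (1 - min μ 1 - b))) ^ 2) := by
          refine setLIntegral_mono measurable_const fun ξ hξ => ENNReal.ofReal_le_ofReal ?_
          rw [← sq_abs]
          gcongr
          exact h.low _ (freq_nonneg _ _) hξ
      _ = ENNReal.ofReal ((C₀ * (S ^ min μ 1 * T ^ (1 - min μ 1 - b))) ^ 2) * volume Z₁ := by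
          rw [setLIntegral_const]
      _ ≤ ENNReal.ofReal ((C₀ * (S ^ min μ 1 * T ^ (1 - min μ 1 - b))) ^ 2) *
            ENNReal.ofReal (C₂ * T ^ (-(n / σ))) := by
          gcongr
          exact H₂ T hT
      _ = ENNReal.ofReal (C₀ ^ 2 * C₂ * ((S ^ min μ 1 * T ^ (-(μ / 2))) ^ 2 * T ^ (-θ))) := by
          rw [← ENNReal.ofReal_mul (by positivity)]
          congr 1
          have e1 : (T ^ (1 - min μ 1 - b)) ^ 2 * T ^ (-(n / σ)) = T ^ (-μ) * T ^ (-θ) := by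
            rw [← Real.rpow_natCast (T ^ _), ← Real.rpow_mul hT.le, ← Real.rpow_add hT,
              ← Real.rpow_add hT]
            congr 1
            push_cast
            rw [hθ, he]
            ring
          rw [mul_pow (S ^ _), hT2, mul_pow, mul_pow]
          linear_combination (C₀ ^ 2 * C₂ * (S ^ min μ 1) ^ 2) * e1
      _ ≤ _ := by
          refine ENNReal.ofReal_le_ofReal ?_
          calc _ ≤ C₀ ^ 2 * C₂ * ((S ^ min μ 1 * T ^ (-(μ / 2))) ^ 2 * (C₃ * L)) := by
                gcongr
                exact H₃ S T hS hST
            _ = _ := by ring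
  have b₂ : ∫⁻ ξ in Z₂, ENNReal.ofReal (κ (freq σ ξ) ^ 2) ≤
      ENNReal.ofReal (C₀ ^ 2 * C₁ * ((S ^ min μ 1 * T ^ (-(μ / 2))) ^ 2 * L)) := by
    calc _ ≤ ∫⁻ ξ in Z₂, ENNReal.ofReal (C₀ ^ 2 * (S ^ min μ 1 * T ^ (-(μ / 2))) ^ 2) *
            ENNReal.ofReal (freq σ ξ ^ (θ - n / σ)) := by
          refine setLIntegral_mono (by fun_prop) fun ξ hξ => ?_
          rw [← ENNReal.ofReal_mul (by positivity)]
          refine ENNReal.ofReal_le_ofReal ?_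
          have hpos : 0 < freq σ ξ := by
            rcases (freq_nonneg σ ξ).eq_or_lt with h' | h'
            · have := hξ.1
              rw [← h'] at this
              simp at this
              linarith
            · exact h'
          rw [← sq_abs]
          calc |κ (freq σ ξ)| ^ 2 ≤ (C₀ * (S ^ min μ 1 * freq σ ξ ^ (min μ 1 + b - 1) *
                (freq σ ξ * T) ^ (-(μ / 2)))) ^ 2 := by
                gcongr
                exact h.middle _ hpos hξ.2 hξ.1
            _ = C₀ ^ 2 * (S ^ min μ 1 * T ^ (-(μ / 2))) ^ 2 *
                (freq σ ξ ^ (min μ 1 + b - 1) * freq σ ξ ^ (-(μ / 2))) ^ 2 := by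
                rw [Real.mul_rpow hpos.le hT.le]
                ring
            _ = _ := by
                rw [← Real.rpow_add hpos, ← Real.rpow_natCast (freq σ ξ ^ _),
                  ← Real.rpow_mul hpos.le]
                congr 2
                push_cast
                rw [hθ, he]
                ring
      _ = ENNReal.ofReal (C₀ ^ 2 * (S ^ min μ 1 * T ^ (-(μ / 2))) ^ 2) *
            ∫⁻ ξ in Z₂, ENNReal.ofReal (freq σ ξ ^ (θ - n / σ)) := by
          rw [lintegral_const_mul _ (by fun_prop)]
      _ ≤ ENNReal.ofReal (C₀ ^ 2 * (S ^ min μ 1 * T ^ (-(μ / 2))) ^ 2) *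
            ENNReal.ofReal (C₁ * L) := by
          gcongr
          exact H₁ S T hS hST'
      _ = _ := by
          rw [← ENNReal.ofReal_mul (by positivity)]
          congr 1
          ring
  calc _ ≤ ∫⁻ ξ in Z₁ ∪ Z₂, ENNReal.ofReal (κ (freq σ ξ) ^ 2) := lintegral_mono_set hsub
    _ ≤ _ := lintegral_union_le _ _ _
    _ ≤ _ := add_le_add b₁ b₂
    _ ≤ _ := by
        rw [← ENNReal.ofReal_add (by positivity) (by positivity)]
        refine ENNReal.ofReal_le_ofReal ?_
        rw [← add_mul]
        exact mul_le_mul_of_nonneg_right (by linarith) (by positivity)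

/-- Hölder in two ways: below `ρ = 1 / S` the multiplier in `L²` against the sup bound `A` of `w`,
above it the multiplier in `L^∞` against the `L²` bound `B`. -/
theorem IsZoneBounded.exists_eLpNorm_le {n : ℕ} (hn : 1 ≤ n) {σ μ b C₀ : ℝ} (hσ : 0 < σ)
    (hC₀ : 0 < C₀) :
    ∃ C : ℝ, 0 < C ∧ ∀ S T W A B : ℝ, ∀ κ : ℝ → ℝ, ∀ w : EuclideanSpace ℝ (Fin n) → ℂ,
      0 < S → S ≤ T → IsZoneBounded μ b C₀ S T κ → Measurable κ →
      AEStronglyMeasurable w volume → 0 ≤ A → (∀ᵐ ξ, ‖w ξ‖ ≤ A) → 0 ≤ B →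
      eLpNorm w 2 volume ≤ ENNReal.ofReal B → 0 ≤ W →
      (2 * S ≤ T → annulusWeight (n / σ - 2 * (μ / 2 + 1 - min μ 1 - b)) S T ^ (1 / 2 : ℝ) ≤ W) →
      eLpNorm (fun ξ => κ (freq σ ξ) • w ξ) 2 volume ≤
        ENNReal.ofReal (C * (S ^ min μ 1 * T ^ (-(μ / 2)) *
          (W * A + S ^ (μ / 2 + 1 - min μ 1 - b) * B))) := by
  obtain ⟨C₁, hC₁, H₁⟩ := IsZoneBounded.exists_lintegral_sq_le hn (μ := μ) (b := b) (C₀ := C₀) hσ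
  set e := μ / 2 + 1 - min μ 1 - b with he
  set θ := n / σ - 2 * e with hθ
  have h2e : 1 ≤ (2 : ℝ) ^ |e| := Real.one_le_rpow one_le_two (abs_nonneg _)
  refine ⟨C₀ * 2 ^ |e| + C₁ ^ (1 / 2 : ℝ), by positivity,
    fun S T W A B κ w hS hST h hκ hw hA hwA hB hwB hW hWL => ?_⟩
  have hT : 0 < T := hS.trans_le hST
  have hfm : Measurable (freq σ : EuclideanSpace ℝ (Fin n) → ℝ) := measurable_freq
  set P := S ^ min μ 1 * T ^ (-(μ / 2)) with hP
  have hP0 : 0 < P := by positivity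
  have hmul : ∀ {c : ℝ} {F : EuclideanSpace ℝ (Fin n) → ℂ}, 0 ≤ c → (∀ ξ, ‖F ξ‖ ≤ c * ‖w ξ‖) →
      eLpNorm F 2 volume ≤ ENNReal.ofReal (c * B) := by
    intro c F hc hF
    calc _ ≤ ENNReal.ofReal c * eLpNorm w 2 volume :=
          eLpNorm_le_mul_eLpNorm_of_ae_le_mul (ae_of_all _ hF) 2
      _ ≤ ENNReal.ofReal c * ENNReal.ofReal B := by gcongr
      _ = _ := (ENNReal.ofReal_mul hc).symm
  -- For `T ≤ 2 S` the multiplier is bounded at all frequencies by the high-zone size, so the term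
  -- in `B` suffices and `W` is only constrained in the other case.
  rcases le_total T (2 * S) with hT2 | hT2
  · refine (hmul (c := C₀ * 2 ^ |e| * (P * S ^ e)) (by positivity) fun ξ => ?_).trans
      (ENNReal.ofReal_le_ofReal ?_)
    · rw [norm_smul, Real.norm_eq_abs]
      gcongr
      exact h.abs_le_of_le_two_mul hC₀.le hS hST hT2 (freq_nonneg _ _)
    · calc _ = C₀ * 2 ^ |e| * (P * (0 + S ^ e * B)) := by ring
        _ ≤ _ := by
          gcongr
          · exact le_add_of_nonneg_right (by positivity)
          · positivity
  · set L := annulusWeight θ S T with hLdef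
    have hL : 0 ≤ L := annulusWeight_nonneg hS hST
    set Z : Set (EuclideanSpace ℝ (Fin n)) := {ξ | freq σ ξ * S ≤ 1} with hZ
    have hZm : MeasurableSet Z := measurableSet_le (hfm.mul_const S) measurable_const
    set F : EuclideanSpace ℝ (Fin n) → ℂ := fun ξ => κ (freq σ ξ) • w ξ with hF
    have hFm : AEStronglyMeasurable F volume :=
      (hκ.comp hfm).aestronglyMeasurable.smul hw
    have hsplit : F = Z.indicator F + Zᶜ.indicator F := (Set.indicator_self_add_compl Z F).symm
    have hhigh : eLpNorm (Zᶜ.indicator F) 2 volume ≤ ENNReal.ofReal (C₀ * (P * S ^ e) * B) := by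
      refine hmul (by positivity) fun ξ => ?_
      by_cases hξ : ξ ∈ Z
      · rw [Set.indicator_of_notMem (by simpa using hξ), norm_zero]
        positivity
      · rw [Set.indicator_of_mem hξ, hF, norm_smul, Real.norm_eq_abs]
        gcongr
        have h1 : 1 < freq σ ξ * S := by simpa [hZ] using hξ
        have hpos : 0 < freq σ ξ := by
          rcases (freq_nonneg σ ξ).eq_or_lt with h' | h'
          · rw [← h'] at h1
            simp at h1
            linarith
          · exact h'
        exact h.high' hS hT hpos h1.le
    have hlow : eLpNorm (Z.indicator F) 2 volume ≤
        ENNReal.ofReal (A * (C₁ ^ (1 / 2 : ℝ) * (P * W))) := by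
      have h1 : eLpNorm (Z.indicator F) 2 volume ≤ ENNReal.ofReal A *
          eLpNorm (Z.indicator fun ξ => κ (freq σ ξ)) 2 volume := by
        refine eLpNorm_le_mul_eLpNorm_of_ae_le_mul ?_ 2
        filter_upwards [hwA] with ξ hξ
        by_cases hξZ : ξ ∈ Z
        · rw [Set.indicator_of_mem hξZ, Set.indicator_of_mem hξZ, hF, norm_smul, mul_comm]
          gcongr
        · rw [Set.indicator_of_notMem hξZ, Set.indicator_of_notMem hξZ]
          simp
      have h2 : eLpNorm (Z.indicator fun ξ => κ (freq σ ξ)) 2 volume ≤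
          ENNReal.ofReal (C₁ ^ (1 / 2 : ℝ) * (P * W)) := by
        rw [eLpNorm_indicator_eq_eLpNorm_restrict hZm,
          eLpNorm_eq_lintegral_rpow_enorm_toReal (by norm_num) (by norm_num)]
        have h3 : ∫⁻ ξ in Z, ‖κ (freq σ ξ)‖ₑ ^ (2 : ℝ≥0∞).toReal =
            ∫⁻ ξ in Z, ENNReal.ofReal (κ (freq σ ξ) ^ 2) := by
          refine lintegral_congr fun ξ => ?_
          rw [← sq_abs, ENNReal.ofReal_pow (abs_nonneg _), Real.enorm_eq_ofReal_abs]
          simp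
        rw [h3]
        calc _ ≤ ENNReal.ofReal (C₁ * (P ^ 2 * L)) ^ (1 / (2 : ℝ≥0∞).toReal) := by
              gcongr
              exact H₁ S T κ hS hT2 h
          _ = ENNReal.ofReal (C₁ ^ (1 / 2 : ℝ) * (P * L ^ (1 / 2 : ℝ))) := by
              rw [ENNReal.toReal_ofNat, ENNReal.ofReal_rpow_of_nonneg (by positivity) (by norm_num),
                Real.mul_rpow hC₁.le (by positivity), Real.mul_rpow (by positivity) hL,
                ← Real.rpow_natCast P, ← Real.rpow_mul hP0.le]
              norm_num
          _ ≤ _ := by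
              gcongr
              exact hWL hT2
      calc _ ≤ _ := h1
        _ ≤ ENNReal.ofReal A * ENNReal.ofReal (C₁ ^ (1 / 2 : ℝ) * (P * W)) := by gcongr
        _ = _ := (ENNReal.ofReal_mul hA).symm
    calc eLpNorm F 2 volume = eLpNorm (Z.indicator F + Zᶜ.indicator F) 2 volume := by rw [← hsplit]
      _ ≤ eLpNorm (Z.indicator F) 2 volume + eLpNorm (Zᶜ.indicator F) 2 volume :=
          eLpNorm_add_le (hFm.indicator hZm) (hFm.indicator hZm.compl) one_le_two
      _ ≤ _ := add_le_add hlow hhigh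
      _ ≤ _ := by
          rw [← ENNReal.ofReal_add (by positivity) (by positivity)]
          refine ENNReal.ofReal_le_ofReal ?_
          have q1 : 0 ≤ C₀ * 2 ^ |e| * (P * (W * A)) := by positivity
          have q2 : 0 ≤ C₁ ^ (1 / 2 : ℝ) * (P * (S ^ e * B)) := by positivity
          have q3 : C₀ * (P * (S ^ e * B)) ≤ C₀ * 2 ^ |e| * (P * (S ^ e * B)) := by
            gcongr
            exact le_mul_of_one_le_right hC₀.le h2e
          nlinarith

/-! ### Fourier transform, multipliers and limits in `L²`. -/

/-- On `L¹ ∩ L²` the Fourier transform of `L²` is bounded by the `L¹` norm. -/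
theorem ae_norm_fourier_le_integral_norm {n : ℕ} (u : L2 n) (hu : Integrable u volume) :
    ∀ᵐ ξ : EuclideanSpace ℝ (Fin n), ‖(𝓕 u : L2 n) ξ‖ ≤ ∫ x, ‖u x‖ := by
  have hcont : Continuous (𝓕 (u : EuclideanSpace ℝ (Fin n) → ℂ)) :=
    VectorFourier.fourierIntegral_continuous Real.continuous_fourierChar
      continuous_inner hu
  -- The `L²` transform is identified with the Fourier integral by testing with smooth compactly
  -- supported functions: both transforms can be moved onto the test function.
  have key : ∀ᵐ ξ : EuclideanSpace ℝ (Fin n), (𝓕 u : L2 n) ξ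
      = 𝓕 (u : EuclideanSpace ℝ (Fin n) → ℂ) ξ := by
    refine ae_eq_of_integral_contDiff_smul_eq
      ((Lp.memLp (𝓕 u : L2 n)).locallyIntegrable one_le_two) hcont.locallyIntegrable
      fun g hg hgs => ?_
    have hg' : ContDiff ℝ (⊤ : ℕ∞) fun x => (g x : ℂ) := Complex.ofRealCLM.contDiff.comp hg
    have hgs' : HasCompactSupport fun x => (g x : ℂ) := hgs.comp_left (g := ((↑) : ℝ → ℂ)) rfl
    set φ : SchwartzMap (EuclideanSpace ℝ (Fin n)) ℂ := hgs'.toSchwartzMap hg' with hφ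
    have hφg : ∀ x, φ x = (g x : ℂ) := fun x => rfl
    have h1 := congrArg (fun T : TemperedDistribution (EuclideanSpace ℝ (Fin n)) ℂ => T φ)
      (Lp.fourier_toTemperedDistribution_eq u)
    simp only [TemperedDistribution.fourier_apply, Lp.toTemperedDistribution_apply] at h1
    have h2 := VectorFourier.integral_fourierIntegral_smul_eq_flip
      (L := innerₗ (EuclideanSpace ℝ (Fin n))) (μ := volume) (ν := volume) (f := φ)
      (g := (u : EuclideanSpace ℝ (Fin n) → ℂ)) Real.continuous_fourierChar continuous_inner
      φ.integrable hu
    rw [flip_innerₗ] at h2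
    have h3 : ∀ x, g x • (𝓕 u : L2 n) x = φ x • (𝓕 u : L2 n) x := fun x => by simp [hφg]
    have h4 : ∀ x, g x • 𝓕 (u : EuclideanSpace ℝ (Fin n) → ℂ) x
        = φ x • 𝓕 (u : EuclideanSpace ℝ (Fin n) → ℂ) x := fun x => by simp [hφg]
    simp only [h3, h4]
    rw [← h1]
    exact h2
  filter_upwards [key] with ξ hξ
  rw [hξ]
  exact VectorFourier.norm_fourierIntegral_le_integral_norm _ _ _ _ _

/-- Multiplication by a bounded function, as an operator on `L²`. -/
noncomputable def mulL2 {n : ℕ} (m : EuclideanSpace ℝ (Fin n) → ℂ) (hm : MemLp m ∞ volume) :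
    L2 n →L[ℂ] L2 n :=
  (ContinuousLinearMap.lsmul ℂ ℂ).holderL volume ∞ 2 2 (hm.toLp m)

theorem coeFn_mulL2 {n : ℕ} {m : EuclideanSpace ℝ (Fin n) → ℂ} (hm : MemLp m ∞ volume)
    (w : L2 n) : mulL2 m hm w =ᵐ[volume] fun ξ => m ξ * w ξ := by
  filter_upwards [(ContinuousLinearMap.lsmul ℂ ℂ).coeFn_holder (r := 2) (hm.toLp m) w,
    hm.coeFn_toLp] with ξ h1 h2
  have h3 : (mulL2 m hm w) ξ = (ContinuousLinearMap.lsmul ℂ ℂ) ((hm.toLp m) ξ) (w ξ) := h1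
  rw [h3, h2]
  simp

theorem exists_fourier_eq_smul {n : ℕ} {m : EuclideanSpace ℝ (Fin n) → ℝ} (hm : Measurable m)
    {C : ℝ} (hC : ∀ ξ, |m ξ| ≤ C) (w : L2 n) :
    ∃ U : L2 n, (𝓕 U : L2 n) =ᵐ[volume] fun ξ => m ξ • w ξ := by
  have hm' : MemLp (fun ξ => (m ξ : ℂ)) ∞ (volume : Measure (EuclideanSpace ℝ (Fin n))) :=
    memLp_top_of_bound (by fun_prop) C (ae_of_all _ fun ξ => by simpa using hC ξ)
  refine ⟨𝓕⁻ (mulL2 _ hm' w), ?_⟩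
  rw [FourierTransform.fourier_fourierInv_eq]
  filter_upwards [coeFn_mulL2 hm' w] with ξ hξ
  rw [hξ, Complex.real_smul]

theorem enorm_eq_of_fourier_ae_eq {n : ℕ} {U : L2 n} {F : EuclideanSpace ℝ (Fin n) → ℂ}
    (h : (𝓕 U : L2 n) =ᵐ[volume] F) : ‖U‖ₑ = eLpNorm F 2 volume := by
  rw [← eLpNorm_congr_ae h, ← Lp.enorm_def, ← ofReal_norm, ← ofReal_norm, Lp.norm_fourier_eq]

/-- Dominated convergence in `L²`. -/
theorem tendsto_eLpNorm_smul {α : Type*} [MeasurableSpace α] {ν : Measure α} {l : Filter ℝ}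
    [l.IsCountablyGenerated] {M : ℝ → α → ℝ} {w : α → ℂ} {C : ℝ} (hw : MemLp w 2 ν)
    (hm : ∀ᶠ τ in l, AEStronglyMeasurable (M τ) ν) (hC : ∀ᶠ τ in l, ∀ ξ, |M τ ξ| ≤ C)
    (hlim : ∀ ξ, Tendsto (fun τ => M τ ξ) l (𝓝 0)) :
    Tendsto (fun τ => eLpNorm (fun ξ => M τ ξ • w ξ) 2 ν) l (𝓝 0) := by
  have hfin : ∫⁻ ξ, ‖C • w ξ‖ₑ ^ (2 : ℝ) ∂ν ≠ ∞ := by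
    have := (hw.const_smul C).eLpNorm_lt_top
    rw [eLpNorm_lt_top_iff_lintegral_rpow_enorm_lt_top two_ne_zero ENNReal.ofNat_ne_top] at this
    simpa using this.ne
  have h0 : Tendsto (fun τ => ∫⁻ ξ, ‖M τ ξ • w ξ‖ₑ ^ (2 : ℝ) ∂ν) l (𝓝 (∫⁻ _, 0 ∂ν)) := by
    refine tendsto_lintegral_filter_of_dominated_convergence' _ ?_ ?_ hfin ?_
    · filter_upwards [hm] with τ hτ
      exact (hτ.smul hw.1).enorm.pow_const _
    · filter_upwards [hC] with τ hτ
      refine ae_of_all _ fun ξ => ?_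
      gcongr
      rw [enorm_le_iff_norm_le, norm_smul, norm_smul]
      gcongr
      exact (hτ ξ).trans (le_abs_self C)
    · refine ae_of_all _ fun ξ => ?_
      have h1 : Tendsto (fun τ => M τ ξ • w ξ) l (𝓝 0) := by
        simpa using (hlim ξ).smul_const (w ξ)
      have h2 := (ENNReal.continuous_rpow_const (y := 2)).tendsto 0 |>.comp
        (by simpa using h1.enorm)
      simpa [Function.comp_def] using h2
  have h3 := (ENNReal.continuous_rpow_const (y := 1 / 2)).tendsto 0 |>.comp (by simpa using h0)
  have h4 : ∀ τ, eLpNorm (fun ξ => M τ ξ • w ξ) 2 ν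
      = (∫⁻ ξ, ‖M τ ξ • w ξ‖ₑ ^ (2 : ℝ) ∂ν) ^ (1 / 2 : ℝ) := by
    intro τ
    rw [eLpNorm_eq_lintegral_rpow_enorm_toReal two_ne_zero ENNReal.ofNat_ne_top,
      ENNReal.toReal_ofNat]
  simp only [h4]
  simpa [Function.comp_def] using h3

theorem freq_sq {n : ℕ} (σ : ℝ) (ξ : EuclideanSpace ℝ (Fin n)) :
    freq σ ξ ^ 2 = (2 * Real.pi * ‖ξ‖) ^ (2 * σ) := by
  rw [freq, ← Real.rpow_natCast, ← Real.rpow_mul (by positivity)]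
  congr 1
  push_cast
  ring

theorem sobolev_weight_le {n : ℕ} {σ : ℝ} (hσ : 0 ≤ σ) (ξ : EuclideanSpace ℝ (Fin n)) :
    (1 + (2 * Real.pi * ‖ξ‖) ^ 2) ^ (σ / 2) ≤ 2 ^ (σ / 2) * (1 + freq σ ξ) := by
  set x := 2 * Real.pi * ‖ξ‖ with hx
  have hx0 : 0 ≤ x := by positivity
  have hfx : freq σ ξ = x ^ σ := rfl
  rw [hfx]
  have hσ2 : 0 ≤ σ / 2 := by positivity
  rcases le_total x 1 with h | h
  · calc (1 + x ^ 2) ^ (σ / 2) ≤ 2 ^ (σ / 2) := by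
          gcongr
          nlinarith
      _ ≤ _ := le_mul_of_one_le_right (by positivity) (by simp; positivity)
  · calc (1 + x ^ 2) ^ (σ / 2) ≤ (2 * x ^ 2) ^ (σ / 2) := by
          gcongr
          nlinarith
      _ = 2 ^ (σ / 2) * x ^ σ := by
          rw [Real.mul_rpow two_pos.le (by positivity), ← Real.rpow_natCast, ← Real.rpow_mul hx0]
          congr 2
          push_cast
          ring
      _ ≤ _ := by
          gcongr
          linarith

theorem eq_of_fourier_ae_eq {n : ℕ} {U V : L2 n} (h : (𝓕 U : L2 n) =ᵐ[volume] (𝓕 V : L2 n)) :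
    U = V :=
  (Lp.fourierTransformₗᵢ (EuclideanSpace ℝ (Fin n)) ℂ).injective (Lp.ext h)

theorem abs_slope_le {F : ℝ → ℝ} {t τ C : ℝ} (hC : 0 ≤ C) (h : |F τ - F t| ≤ C * |τ - t|) :
    |slope F t τ| ≤ C := by
  rw [slope_def_field, abs_div]
  exact div_le_of_le_mul₀ (abs_nonneg _) hC h

/-- Dominated convergence of difference quotients based at the single time `t`, one-sided at `s`. It
serves the weak equation, with `G` the time derivative of the mode and `I` the product of the test
function with the data in frequency space. -/
theorem hasDerivWithinAt_integral_smul {α : Type*} [MeasurableSpace α] {ν : Measure α}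
    {s t : ℝ} {G : α → ℝ → ℝ} {G' L : α → ℝ} {I : α → ℂ} (ht : s ≤ t)
    (hI : AEStronglyMeasurable I ν)
    (hG : ∀ τ, s ≤ τ → AEStronglyMeasurable (fun x => G x τ) ν)
    (hGI : ∀ τ, s ≤ τ → Integrable (fun x => G x τ • I x) ν)
    (hL0 : ∀ x, 0 ≤ L x)
    (hL : ∀ x τ, s ≤ τ → |G x τ - G x t| ≤ L x * |τ - t|)
    (hLI : Integrable (fun x => L x * ‖I x‖) ν)
    (hd : ∀ x, HasDerivWithinAt (G x) (G' x) (Set.Ici s) t) :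
    HasDerivWithinAt (fun τ => ∫ x, G x τ • I x ∂ν) (∫ x, G' x • I x ∂ν) (Set.Ici s) t := by
  rw [hasDerivWithinAt_iff_tendsto_slope]
  have hmem : ∀ᶠ τ in 𝓝[Set.Ici s \ {t}] t, s ≤ τ := by
    filter_upwards [self_mem_nhdsWithin] with τ hτ using hτ.1
  have h1 : Tendsto (fun τ => ∫ x, slope (G x) t τ • I x ∂ν) (𝓝[Set.Ici s \ {t}] t)
      (𝓝 (∫ x, G' x • I x ∂ν)) := by
    refine tendsto_integral_filter_of_dominated_convergence (fun x => L x * ‖I x‖) ?_ ?_ hLI ?_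
    · filter_upwards [hmem] with τ hτ
      have : AEStronglyMeasurable (fun x => slope (G x) t τ) ν := by
        simp only [slope_def_field, div_eq_mul_inv]
        exact ((hG τ hτ).sub (hG t ht)).mul_const _
      exact this.smul hI
    · filter_upwards [hmem] with τ hτ
      refine ae_of_all _ fun x => ?_
      rw [norm_smul, Real.norm_eq_abs]
      gcongr
      exact abs_slope_le (hL0 x) (hL x τ hτ)
    · exact ae_of_all _ fun x => (hasDerivWithinAt_iff_tendsto_slope.1 (hd x)).smul_const _
  refine h1.congr' ?_
  filter_upwards [hmem] with τ hτ
  rw [slope_def_module, ← integral_sub (hGI τ hτ) (hGI t ht), ← integral_smul]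
  refine integral_congr_ae (ae_of_all _ fun x => ?_)
  simp only
  rw [slope_def_module, ← sub_smul, smul_assoc]

/-! ### Construction of the energy solution. -/

namespace IsDampedMode

variable {μ s ρ : ℝ} {f g : ℝ → ℝ}

theorem abs_sub_le (h : IsDampedMode μ s ρ f g) (hμ : 0 ≤ μ) (hs : 0 ≤ s) {t τ : ℝ} (ht : s ≤ t)
    (hτ : s ≤ τ) : |f τ - f t| ≤ 1 * |τ - t| :=
  (convex_Ici s).norm_image_sub_le_of_norm_hasDerivWithin_le
    (fun _ hx => (h.deriv _ hx).hasDerivWithinAt)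
    (fun _ hx => h.abs_deriv_le_one hμ hs hx) ht hτ

/-- The energy bound gives `ρ² |f| ≤ ρ`, so the Lipschitz constant grows only linearly in `ρ`, which
a test function in `H^{2σ}` can absorb. -/
theorem abs_deriv_sub_le (h : IsDampedMode μ s ρ f g) (hμ : 0 ≤ μ) (hs : 0 ≤ s) (hρ : 0 ≤ ρ)
    {t τ : ℝ} (ht : s ≤ t) (hτ : s ≤ τ) : |g τ - g t| ≤ (ρ + μ) * |τ - t| := by
  refine (convex_Ici s).norm_image_sub_le_of_norm_hasDerivWithin_le
    (fun x hx => (h.deriv₂ x hx).hasDerivWithinAt) (fun x hx => ?_) ht hτ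
  have hx' : s ≤ x := hx
  have h1 := h.abs_deriv_le_one hμ hs hx
  have h2 := h.abs_mul_le_one hμ hs hx
  have h3 : |ρ ^ 2 * f x| ≤ ρ := by
    rw [sq, mul_assoc, abs_mul, abs_of_nonneg hρ]
    exact mul_le_of_le_one_right hρ h2
  have h4 : |μ / (1 + x) * g x| ≤ μ := by
    rw [abs_mul, abs_of_nonneg (by have : 0 ≤ 1 + x := by linarith
                                   positivity)]
    have : μ / (1 + x) ≤ μ := div_le_self hμ (by linarith)
    calc _ ≤ μ * 1 := by gcongr
      _ = μ := mul_one μ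
  calc ‖-(ρ ^ 2 * f x) - μ / (1 + x) * g x‖ ≤ ‖-(ρ ^ 2 * f x)‖ + ‖μ / (1 + x) * g x‖ :=
        norm_sub_le _ _
    _ ≤ ρ + μ := by
        rw [norm_neg]
        exact add_le_add h3 h4

end IsDampedMode

/-- The modes multiply `û₁`. All limits in `L²` and `H^σ` follow by dominated convergence from
bounds uniform in `ρ`: `|f| ≤ t - s`, `|ρ f| ≤ 1`, `|g| ≤ 1`, and `f` is `1`-Lipschitz in time. -/
theorem exists_isEnergySolution {n : ℕ} {σ μ s : ℝ} (hσ : 0 ≤ σ) (hμ : 0 ≤ μ) (hs : 0 ≤ s)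
    {f g : ℝ → ℝ → ℝ} (h : ∀ ρ, IsDampedMode μ s ρ (f ρ) (g ρ))
    (hfm : ∀ t, Measurable fun ρ => f ρ t) (hgm : ∀ t, Measurable fun ρ => g ρ t) (u₁ : L2 n) :
    ∃ u v : ℝ → L2 n, IsEnergySolution σ μ s u₁ u v ∧
      (∀ t, s ≤ t → (𝓕 (u t) : L2 n) =ᵐ[volume] fun ξ => f (freq σ ξ) t • (𝓕 u₁ : L2 n) ξ) ∧
      ∀ t, s ≤ t → (𝓕 (v t) : L2 n) =ᵐ[volume] fun ξ => g (freq σ ξ) t • (𝓕 u₁ : L2 n) ξ := by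
  set w : L2 n := 𝓕 u₁ with hw
  have hq : Measurable (freq σ : EuclideanSpace ℝ (Fin n) → ℝ) := measurable_freq
  have hq0 : ∀ ξ : EuclideanSpace ℝ (Fin n), 0 ≤ freq σ ξ := freq_nonneg σ
  have hfq : ∀ t, Measurable fun ξ : EuclideanSpace ℝ (Fin n) => f (freq σ ξ) t :=
    fun t => (hfm t).comp hq
  have hgq : ∀ t, Measurable fun ξ : EuclideanSpace ℝ (Fin n) => g (freq σ ξ) t :=
    fun t => (hgm t).comp hq
  -- Times before `s` receive the default value `0`.
  have hu : ∀ t, ∃ U : L2 n, s ≤ t → (𝓕 U : L2 n) =ᵐ[volume] fun ξ => f (freq σ ξ) t • w ξ := by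
    intro t
    by_cases ht : s ≤ t
    · obtain ⟨U, hU⟩ := exists_fourier_eq_smul (hfq t)
        (fun ξ => (h (freq σ ξ)).abs_le_sub hμ hs ht) w
      exact ⟨U, fun _ => hU⟩
    · exact ⟨0, fun h => absurd h ht⟩
  have hv : ∀ t, ∃ U : L2 n, s ≤ t → (𝓕 U : L2 n) =ᵐ[volume] fun ξ => g (freq σ ξ) t • w ξ := by
    intro t
    by_cases ht : s ≤ t
    · obtain ⟨U, hU⟩ := exists_fourier_eq_smul (hgq t)
        (fun ξ => (h (freq σ ξ)).abs_deriv_le_one hμ hs ht) w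
      exact ⟨U, fun _ => hU⟩
    · exact ⟨0, fun h => absurd h ht⟩
  choose u hu using hu
  choose v hv using hv
  have hsub : ∀ t τ, s ≤ t → s ≤ τ → (𝓕 (u τ - u t) : L2 n) =ᵐ[volume]
      fun ξ => (f (freq σ ξ) τ - f (freq σ ξ) t) • w ξ := by
    intro t τ ht hτ
    have e : (𝓕 (u τ - u t) : L2 n) = 𝓕 (u τ) - 𝓕 (u t) :=
      (Lp.fourierTransformₗᵢ (EuclideanSpace ℝ (Fin n)) ℂ).map_sub _ _
    rw [e]
    filter_upwards [Lp.coeFn_sub (𝓕 (u τ) : L2 n) (𝓕 (u t)), hu τ hτ, hu t ht] with ξ h1 h2 h3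
    rw [h1, Pi.sub_apply, h2, h3, sub_smul]
  have hsubv : ∀ t τ, s ≤ t → s ≤ τ → (𝓕 (v τ - v t) : L2 n) =ᵐ[volume]
      fun ξ => (g (freq σ ξ) τ - g (freq σ ξ) t) • w ξ := by
    intro t τ ht hτ
    have e : (𝓕 (v τ - v t) : L2 n) = 𝓕 (v τ) - 𝓕 (v t) :=
      (Lp.fourierTransformₗᵢ (EuclideanSpace ℝ (Fin n)) ℂ).map_sub _ _
    rw [e]
    filter_upwards [Lp.coeFn_sub (𝓕 (v τ) : L2 n) (𝓕 (v t)), hv τ hτ, hv t ht] with ξ h1 h2 h3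
    rw [h1, Pi.sub_apply, h2, h3, sub_smul]
  have hwL : MemLp w 2 volume := Lp.memLp w
  have hweight : ∀ {ξ : EuclideanSpace ℝ (Fin n)} {a A B : ℝ}, |a| ≤ A → |freq σ ξ * a| ≤ B →
      |(1 + (2 * Real.pi * ‖ξ‖) ^ 2) ^ (σ / 2) * a| ≤ 2 ^ (σ / 2) * (A + B) := by
    intro ξ a A B h1 h2
    rw [abs_mul, abs_of_nonneg (by positivity)]
    rw [abs_mul, abs_of_nonneg (hq0 ξ)] at h2
    calc _ ≤ 2 ^ (σ / 2) * (1 + freq σ ξ) * |a| := by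
          gcongr
          exact sobolev_weight_le hσ ξ
      _ = 2 ^ (σ / 2) * (|a| + freq σ ξ * |a|) := by ring
      _ ≤ _ := by gcongr
  have hwm : Measurable fun ξ : EuclideanSpace ℝ (Fin n) =>
      (1 + (2 * Real.pi * ‖ξ‖) ^ 2) ^ (σ / 2) := by fun_prop
  refine ⟨u, v, ⟨?_, ?_, ?_, ?_, ?_, ?_, ?_⟩, hu, hv⟩
  · intro t ht
    have e : sobolevNorm σ (u t) = eLpNorm (fun ξ : EuclideanSpace ℝ (Fin n) =>
        ((1 + (2 * Real.pi * ‖ξ‖) ^ 2) ^ (σ / 2) * f (freq σ ξ) t) • w ξ) 2 volume := by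
      refine eLpNorm_congr_ae ?_
      filter_upwards [hu t ht] with ξ hξ
      rw [hξ, smul_smul]
    rw [e]
    refine lt_of_le_of_lt (eLpNorm_le_mul_eLpNorm_of_ae_le_mul
      (c := 2 ^ (σ / 2) * ((t - s) + 1)) (g := w) (ae_of_all _ fun ξ => ?_) 2)
      (ENNReal.mul_lt_top ENNReal.ofReal_lt_top hwL.2)
    rw [norm_smul, Real.norm_eq_abs]
    gcongr
    exact hweight ((h _).abs_le_sub hμ hs ht) ((h _).abs_mul_le_one hμ hs ht)
  · intro t ht
    have e : ∀ᶠ τ in 𝓝[Set.Ici s] t, eLpNorm (fun ξ : EuclideanSpace ℝ (Fin n) =>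
        ((1 + (2 * Real.pi * ‖ξ‖) ^ 2) ^ (σ / 2) * (f (freq σ ξ) τ - f (freq σ ξ) t)) • w ξ) 2
          volume = sobolevNorm σ (u τ - u t) := by
      filter_upwards [self_mem_nhdsWithin] with τ hτ
      refine eLpNorm_congr_ae ?_
      filter_upwards [hsub t τ ht hτ] with ξ hξ
      rw [hξ, smul_smul]
    refine Tendsto.congr' e ?_
    refine tendsto_eLpNorm_smul (C := 2 ^ (σ / 2) * (1 + (1 + 1))) hwL ?_ ?_ fun ξ => ?_
    · exact Eventually.of_forall fun τ => (hwm.mul ((hfq τ).sub (hfq t))).aestronglyMeasurable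
    · have hnear : ∀ᶠ τ in 𝓝[Set.Ici s] t, |τ - t| ≤ 1 := by
        filter_upwards [nhdsWithin_le_nhds (Metric.closedBall_mem_nhds t one_pos)] with τ hτ
        simpa [Real.dist_eq] using hτ
      filter_upwards [self_mem_nhdsWithin, hnear] with τ hτ h1 ξ
      refine hweight ?_ ?_
      · have := (h (freq σ ξ)).abs_sub_le hμ hs ht hτ
        linarith
      · rw [mul_sub]
        exact (abs_sub _ _).trans (add_le_add ((h _).abs_mul_le_one hμ hs hτ)
          ((h _).abs_mul_le_one hμ hs ht))
    · have h1 := ((h (freq σ ξ)).deriv t ht).continuousAt.continuousWithinAt (s := Set.Ici s)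
      simpa using (h1.tendsto.sub_const (f (freq σ ξ) t)).const_mul
        ((1 + (2 * Real.pi * ‖ξ‖) ^ 2) ^ (σ / 2))
  · intro t ht
    rw [hasDerivWithinAt_iff_tendsto_slope, tendsto_iff_norm_sub_tendsto_zero]
    have hmem : ∀ᶠ τ in 𝓝[Set.Ici s \ {t}] t, s ≤ τ := by
      filter_upwards [self_mem_nhdsWithin] with τ hτ using hτ.1
    have e : ∀ᶠ τ in 𝓝[Set.Ici s \ {t}] t, (eLpNorm (fun ξ : EuclideanSpace ℝ (Fin n) =>
        (slope (f (freq σ ξ)) t τ - g (freq σ ξ) t) • w ξ) 2 volume).toReal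
          = ‖slope u t τ - v t‖ := by
      filter_upwards [hmem] with τ hτ
      rw [← toReal_enorm]
      congr 1
      refine (enorm_eq_of_fourier_ae_eq ?_).symm
      have e1 : (𝓕 (slope u t τ - v t) : L2 n)
          = ((τ - t)⁻¹ : ℝ) • (𝓕 (u τ - u t) : L2 n) - 𝓕 (v t) := by
        rw [slope_def_module]
        change Lp.fourierTransformₗᵢ (EuclideanSpace ℝ (Fin n)) ℂ _ = _
        rw [map_sub, map_real_smul _ (Lp.fourierTransformₗᵢ (EuclideanSpace ℝ (Fin n)) ℂ).continuous]
        rfl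
      rw [e1]
      filter_upwards [Lp.coeFn_sub (((τ - t)⁻¹ : ℝ) • (𝓕 (u τ - u t) : L2 n)) (𝓕 (v t)),
        Lp.coeFn_smul ((τ - t)⁻¹ : ℝ) (𝓕 (u τ - u t) : L2 n), hsub t τ ht hτ, hv t ht]
        with ξ h1 h2 h3 h4
      rw [h1, Pi.sub_apply, h2, Pi.smul_apply, h3, h4, slope_def_module, ← smul_assoc, ← sub_smul]
    refine Tendsto.congr' e ?_
    have := tendsto_eLpNorm_smul (l := 𝓝[Set.Ici s \ {t}] t) (C := 1 + 1)
      (M := fun τ (ξ : EuclideanSpace ℝ (Fin n)) => slope (f (freq σ ξ)) t τ - g (freq σ ξ) t)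
      hwL ?_ ?_ fun ξ => ?_
    · simpa [Function.comp_def] using (ENNReal.tendsto_toReal ENNReal.zero_ne_top).comp this
    · refine Eventually.of_forall fun τ => ?_
      simp only [slope_def_field]
      exact ((((hfq τ).sub (hfq t)).div_const _).sub (hgq t)).aestronglyMeasurable
    · filter_upwards [hmem] with τ hτ ξ
      exact (abs_sub _ _).trans (add_le_add
        (abs_slope_le zero_le_one ((h _).abs_sub_le hμ hs ht hτ)) ((h _).abs_deriv_le_one hμ hs ht))
    · have h1 := hasDerivWithinAt_iff_tendsto_slope.1
        (((h (freq σ ξ)).deriv t ht).hasDerivWithinAt (s := Set.Ici s))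
      simpa using h1.sub_const (g (freq σ ξ) t)
  · intro t ht
    rw [ContinuousWithinAt, tendsto_iff_norm_sub_tendsto_zero]
    have e : ∀ᶠ τ in 𝓝[Set.Ici s] t, (eLpNorm (fun ξ : EuclideanSpace ℝ (Fin n) =>
        (g (freq σ ξ) τ - g (freq σ ξ) t) • w ξ) 2 volume).toReal = ‖v τ - v t‖ := by
      filter_upwards [self_mem_nhdsWithin] with τ hτ
      rw [← toReal_enorm, enorm_eq_of_fourier_ae_eq (hsubv t τ ht hτ)]
    refine Tendsto.congr' e ?_
    have := tendsto_eLpNorm_smul (l := 𝓝[Set.Ici s] t) (C := 1 + 1)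
      (M := fun τ (ξ : EuclideanSpace ℝ (Fin n)) => g (freq σ ξ) τ - g (freq σ ξ) t)
      hwL ?_ ?_ fun ξ => ?_
    · simpa [Function.comp_def] using (ENNReal.tendsto_toReal ENNReal.zero_ne_top).comp this
    · exact Eventually.of_forall fun τ => ((hgq τ).sub (hgq t)).aestronglyMeasurable
    · filter_upwards [self_mem_nhdsWithin] with τ hτ ξ
      exact (abs_sub _ _).trans (add_le_add ((h _).abs_deriv_le_one hμ hs hτ)
        ((h _).abs_deriv_le_one hμ hs ht))
    · have h1 := ((h (freq σ ξ)).deriv₂ t ht).continuousAt.continuousWithinAt (s := Set.Ici s)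
      simpa using h1.tendsto.sub_const (g (freq σ ξ) t)
  · refine eq_of_fourier_ae_eq ?_
    have e : (𝓕 (0 : L2 n) : L2 n) = 0 :=
      (Lp.fourierTransformₗᵢ (EuclideanSpace ℝ (Fin n)) ℂ).map_zero
    rw [e]
    filter_upwards [hu s le_rfl, Lp.coeFn_zero ℂ 2 (volume : Measure (EuclideanSpace ℝ (Fin n)))]
      with ξ h1 h2
    rw [h1, h2, (h _).initial]
    simp
  · refine eq_of_fourier_ae_eq ?_
    filter_upwards [hv s le_rfl] with ξ h1
    rw [h1, (h _).initial_deriv, one_smul]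
  -- By Plancherel both pairings become integrals of the mode against `I`, and the ODE of the mode
  -- is integrated against `I`.
  · intro φ γ hφ t ht
    set I : EuclideanSpace ℝ (Fin n) → ℂ := fun ξ => inner ℂ ((𝓕 φ : L2 n) ξ) (w ξ) with hI
    have hφγ : ∀ᵐ ξ : EuclideanSpace ℝ (Fin n),
        (𝓕 γ : L2 n) ξ = (freq σ ξ ^ 2) • (𝓕 φ : L2 n) ξ := by
      filter_upwards [hφ] with ξ hξ
      rw [hξ, freq_sq]
    have hinner_v : ∀ τ, s ≤ τ → inner ℂ φ (v τ) = ∫ ξ, g (freq σ ξ) τ • I ξ := by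
      intro τ hτ
      rw [← Lp.inner_fourier_eq, L2.inner_def]
      refine integral_congr_ae ?_
      filter_upwards [hv τ hτ] with ξ hξ
      rw [hξ, ← Complex.coe_smul, inner_smul_right, ← Complex.real_smul]
    have hint_v : ∀ τ, s ≤ τ → Integrable (fun ξ => g (freq σ ξ) τ • I ξ) volume := by
      intro τ hτ
      refine (L2.integrable_inner (𝕜 := ℂ) (𝓕 φ : L2 n) (𝓕 (v τ) : L2 n)).congr ?_
      filter_upwards [hv τ hτ] with ξ hξ
      rw [hξ, ← Complex.coe_smul, inner_smul_right, ← Complex.real_smul]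
    have hpt_u : ∀ᵐ ξ : EuclideanSpace ℝ (Fin n),
        inner ℂ ((𝓕 γ : L2 n) ξ) ((𝓕 (u t) : L2 n) ξ) = (freq σ ξ ^ 2 * f (freq σ ξ) t) • I ξ := by
      filter_upwards [hu t ht, hφγ] with ξ h1 h2
      rw [h1, h2, ← Complex.coe_smul, ← Complex.coe_smul, inner_smul_right, inner_smul_left,
        Complex.conj_ofReal, ← Complex.coe_smul]
      push_cast
      simp only [smul_eq_mul, hI]
      ring
    have hinner_u : inner ℂ γ (u t) = ∫ ξ, (freq σ ξ ^ 2 * f (freq σ ξ) t) • I ξ := by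
      rw [← Lp.inner_fourier_eq, L2.inner_def]
      exact integral_congr_ae hpt_u
    have hint_u : Integrable (fun ξ => (freq σ ξ ^ 2 * f (freq σ ξ) t) • I ξ) volume :=
      (L2.integrable_inner (𝕜 := ℂ) (𝓕 γ : L2 n) (𝓕 (u t) : L2 n)).congr hpt_u
    have hIm : AEStronglyMeasurable I volume :=
      (L2.integrable_inner (𝕜 := ℂ) (𝓕 φ : L2 n) w).aestronglyMeasurable
    -- Here `ρ + μ ≤ (1 + μ) + ρ²`, and `ρ² φ̂` is the transform of `γ`, hence in `L²`.
    have hLI : Integrable (fun ξ : EuclideanSpace ℝ (Fin n) => (freq σ ξ + μ) * ‖I ξ‖) volume := by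
      have b1 : Integrable (fun ξ => ‖(𝓕 φ : L2 n) ξ‖ * ‖w ξ‖) volume :=
        (Lp.memLp (𝓕 φ : L2 n)).norm.integrable_mul (q := 2) hwL.norm
      have b2 : Integrable (fun ξ => ‖(𝓕 γ : L2 n) ξ‖ * ‖w ξ‖) volume :=
        (Lp.memLp (𝓕 γ : L2 n)).norm.integrable_mul (q := 2) hwL.norm
      refine ((b1.const_mul (1 + μ)).add b2).mono'
        ((hq.add_const μ).aestronglyMeasurable.mul hIm.norm) ?_
      filter_upwards [hφγ] with ξ h1
      have h2 : ‖I ξ‖ ≤ ‖(𝓕 φ : L2 n) ξ‖ * ‖w ξ‖ := norm_inner_le_norm _ _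
      have h3 : ‖(𝓕 γ : L2 n) ξ‖ = freq σ ξ ^ 2 * ‖(𝓕 φ : L2 n) ξ‖ := by
        rw [h1, norm_smul, Real.norm_eq_abs, abs_of_nonneg (by positivity)]
      have h4 := hq0 ξ
      rw [norm_mul, norm_norm, Real.norm_eq_abs, abs_of_nonneg (by positivity), Pi.add_apply, h3]
      calc (freq σ ξ + μ) * ‖I ξ‖ ≤ ((1 + μ) + freq σ ξ ^ 2) * (‖(𝓕 φ : L2 n) ξ‖ * ‖w ξ‖) := by
            gcongr ?_ * ?_
            nlinarith [sq_nonneg (freq σ ξ - 1)]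
        _ = _ := by ring
    have hder := hasDerivWithinAt_integral_smul (G := fun ξ τ => g (freq σ ξ) τ)
      (G' := fun ξ => -(freq σ ξ ^ 2 * f (freq σ ξ) t) - μ / (1 + t) * g (freq σ ξ) t)
      (L := fun ξ => freq σ ξ + μ) ht hIm (fun τ _ => (hgq τ).aestronglyMeasurable) hint_v
      (fun ξ => add_nonneg (hq0 ξ) hμ) (fun ξ τ hτ => (h _).abs_deriv_sub_le hμ hs (hq0 ξ) ht hτ)
      hLI fun ξ => ((h _).deriv₂ t ht).hasDerivWithinAt
    have hint_neg : Integrable (fun ξ => -((freq σ ξ ^ 2 * f (freq σ ξ) t) • I ξ)) volume :=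
      hint_u.neg
    have hval : ∫ ξ, (-(freq σ ξ ^ 2 * f (freq σ ξ) t) - μ / (1 + t) * g (freq σ ξ) t) • I ξ
        = -(inner ℂ γ (u t)) - ((μ / (1 + t) : ℝ) : ℂ) * inner ℂ φ (v t) := by
      rw [hinner_u, hinner_v t ht, ← integral_neg, ← integral_const_mul,
        ← integral_sub hint_neg ((hint_v t ht).const_mul _)]
      refine integral_congr_ae (ae_of_all _ fun ξ => ?_)
      simp only [Complex.real_smul]
      push_cast
      ring
    rw [hval] at hder
    exact hder.congr (fun τ hτ => hinner_v τ hτ) (hinner_v t ht)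

/-! ### Uniqueness of the energy solution. -/

/-- A weakly differentiable curve in an inner product space whose weak derivative is continuous is
differentiable. -/
theorem hasDerivWithinAt_of_inner {H : Type*} [NormedAddCommGroup H] [InnerProductSpace ℂ H]
    {V W : ℝ → H} {s : ℝ} (hW : ContinuousOn W (Set.Ici s))
    (h : ∀ ψ t, s ≤ t →
      HasDerivWithinAt (fun τ => inner ℂ ψ (V τ)) (inner ℂ ψ (W t)) (Set.Ici s) t)
    {t : ℝ} (ht : s ≤ t) : HasDerivWithinAt V (W t) (Set.Ici s) t := by
  rw [hasDerivWithinAt_iff_isLittleO, Asymptotics.isLittleO_iff]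
  intro ε hε
  obtain ⟨δ, hδ, hδW⟩ := Metric.continuousWithinAt_iff.1 (hW t ht) ε hε
  filter_upwards [self_mem_nhdsWithin, nhdsWithin_le_nhds (Metric.ball_mem_nhds t hδ)] with τ hτ hτt
  -- The remainder `D` is itself taken as test vector: the mean value inequality for `⟨D, V r - r W
  -- t⟩` gives `‖D‖² ≤ ‖D‖ ε |τ - t|`.
  set D := V τ - V t - (τ - t) • W t with hD
  have hmv := ((convex_Ici s).inter (convex_ball t δ)).norm_image_sub_le_of_norm_hasDerivWithin_le
    (f := fun r => inner ℂ D (V r) - (r : ℂ) * inner ℂ D (W t))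
    (f' := fun r => inner ℂ D (W r) - inner ℂ D (W t)) (C := ‖D‖ * ε) (x := t) (y := τ)
    (fun r hr => by
      have h1 : HasDerivWithinAt (fun r : ℝ => (r : ℂ) * inner ℂ D (W t)) (1 * inner ℂ D (W t))
          (Set.Ici s) r := (Complex.ofRealCLM.hasDerivAt.mul_const _).hasDerivWithinAt
      rw [one_mul] at h1
      exact ((h D r hr.1).sub h1).mono Set.inter_subset_left)
    (fun r hr => by
      rw [← inner_sub_right]
      refine (norm_inner_le_norm _ _).trans ?_
      gcongr
      have := hδW hr.1 hr.2
      rw [dist_eq_norm] at this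
      exact this.le)
    ⟨ht, Metric.mem_ball_self hδ⟩ ⟨hτ, hτt⟩
  have h2 : inner ℂ D (V τ) - (τ : ℂ) * inner ℂ D (W t) -
      (inner ℂ D (V t) - (t : ℂ) * inner ℂ D (W t)) = inner ℂ D D := by
    conv_rhs => rw [hD, inner_sub_right, inner_sub_right, ← hD, ← Complex.coe_smul,
      inner_smul_right]
    push_cast
    ring
  rw [h2, inner_self_eq_norm_sq_to_K] at hmv
  have h3 : ‖D‖ * ‖D‖ ≤ ‖D‖ * (ε * ‖τ - t‖) := by
    have : ‖((‖D‖ : ℂ)) ^ 2‖ = ‖D‖ * ‖D‖ := by simp [sq]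
    calc ‖D‖ * ‖D‖ = ‖((‖D‖ : ℂ)) ^ 2‖ := this.symm
      _ ≤ ‖D‖ * ε * ‖τ - t‖ := hmv
      _ = _ := by ring
  rcases (norm_nonneg D).eq_or_lt with h4 | h4
  · rw [← h4]
    positivity
  · exact le_of_mul_le_mul_left h3 h4

theorem inner_mulL2_left {n : ℕ} {m : EuclideanSpace ℝ (Fin n) → ℝ}
    (hm : MemLp (fun ξ => (m ξ : ℂ)) ∞ volume) (ψ w : L2 n) :
    inner ℂ (mulL2 _ hm ψ) w = inner ℂ ψ (mulL2 _ hm w) := by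
  rw [L2.inner_def, L2.inner_def]
  refine integral_congr_ae ?_
  filter_upwards [coeFn_mulL2 hm ψ, coeFn_mulL2 hm w] with ξ h1 h2
  rw [h1, h2, ← smul_eq_mul, ← smul_eq_mul, inner_smul_left, inner_smul_right, Complex.conj_ofReal]

/-- The velocity is only in `L²`, so it cannot be used as a test function in an energy identity.
After a cutoff to `freq σ ξ ≤ R` the operator `(-Δ) ^ σ` is bounded, the difference of two solutions
satisfies a linear ODE in `L²` with zero data, and a Grönwall argument makes it vanish; then `R`
exhausts all frequencies. -/
theorem IsEnergySolution.unique {n : ℕ} {σ μ s : ℝ} (hμ : 0 ≤ μ) (hs : 0 ≤ s) {u₁ : L2 n}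
    {u v u' v' : ℝ → L2 n} (h : IsEnergySolution σ μ s u₁ u v)
    (h' : IsEnergySolution σ μ s u₁ u' v') {t : ℝ} (ht : s ≤ t) : u' t = u t ∧ v' t = v t := by
  let F := Lp.fourierTransformₗᵢ (EuclideanSpace ℝ (Fin n)) ℂ
  let U : ℝ → L2 n := fun t => F (u t - u' t)
  let V : ℝ → L2 n := fun t => F (v t - v' t)
  have hUd : ∀ t, s ≤ t → HasDerivWithinAt U (V t) (Set.Ici s) t := fun t ht =>
    (F.toContinuousLinearEquiv.toContinuousLinearMap.restrictScalars
      ℝ).hasFDerivAt.comp_hasDerivWithinAt t ((h.hasDeriv t ht).sub (h'.hasDeriv t ht))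
  have hVc : ContinuousOn V (Set.Ici s) :=
    F.continuous.comp_continuousOn (h.continuous_deriv.sub h'.continuous_deriv)
  have hUc : ContinuousOn U (Set.Ici s) := fun t ht => (hUd t ht).continuousWithinAt
  have hU0 : U s = 0 := by simp [U, h.initial, h'.initial]
  have hV0 : V s = 0 := by simp [V, h.initial_deriv, h'.initial_deriv]
  have hq : Measurable (freq σ : EuclideanSpace ℝ (Fin n) → ℝ) := measurable_freq
  have key : ∀ R : ℕ, ∀ t, s ≤ t → ∀ᵐ ξ : EuclideanSpace ℝ (Fin n), freq σ ξ ≤ R →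
      U t ξ = 0 ∧ V t ξ = 0 := by
    intro R
    set Z : Set (EuclideanSpace ℝ (Fin n)) := {ξ | freq σ ξ ≤ R} with hZ
    have hZm : MeasurableSet Z := measurableSet_le hq measurable_const
    have hm₀ : MemLp (fun ξ => ((Z.indicator (fun _ => (1 : ℝ)) ξ : ℝ) : ℂ)) ∞ volume := by
      refine memLp_top_of_bound (Complex.measurable_ofReal.comp
        (measurable_const.indicator hZm)).aestronglyMeasurable 1 (ae_of_all _ fun ξ => ?_)
      by_cases hξ : ξ ∈ Z <;> simp [hξ]
    have hm₁ : MemLp (fun ξ => ((Z.indicator (fun ξ => freq σ ξ ^ 2) ξ : ℝ) : ℂ)) ∞ volume := by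
      refine memLp_top_of_bound (Complex.measurable_ofReal.comp
        ((hq.pow_const 2).indicator hZm)).aestronglyMeasurable ((R : ℝ) ^ 2) (ae_of_all _ fun ξ => ?_)
      by_cases hξ : ξ ∈ Z
      · rw [Set.indicator_of_mem hξ, Complex.norm_real, Real.norm_eq_abs,
          abs_of_nonneg (by positivity)]
        have := freq_nonneg σ ξ
        gcongr
        exact hξ
      · simp [hξ]
    -- `P` is the frequency cutoff and `Q` is `(-Δ) ^ σ` composed with it, both on the Fourier side.
    let P := mulL2 _ hm₀
    let Q := mulL2 _ hm₁
    let a : ℝ → L2 n := fun t => P (U t)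
    let b : ℝ → L2 n := fun t => P (V t)
    let W : ℝ → L2 n := fun t => -Q (U t) - ((μ / (1 + t) : ℝ) : ℂ) • b t
    have had : ∀ t, s ≤ t → HasDerivWithinAt a (b t) (Set.Ici s) t := fun t ht =>
      (P.restrictScalars ℝ).hasFDerivAt.comp_hasDerivWithinAt t (hUd t ht)
    have hbc : ContinuousOn b (Set.Ici s) := P.continuous.comp_continuousOn hVc
    have hWc : ContinuousOn W (Set.Ici s) := by
      have hc : ContinuousOn (fun t : ℝ => ((μ / (1 + t) : ℝ) : ℂ)) (Set.Ici s) := ?_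
      · exact (Q.continuous.comp_continuousOn hUc).neg.sub (hc.smul hbc)
      refine Complex.continuous_ofReal.comp_continuousOn (continuousOn_const.div (by fun_prop) ?_)
      intro r hr
      have : s ≤ r := hr
      linarith
    have hbd : ∀ t, s ≤ t → HasDerivWithinAt b (W t) (Set.Ici s) t := by
      refine fun t ht => hasDerivWithinAt_of_inner hWc (fun ψ t ht => ?_) ht
      have hF : ∀ x, F (F.symm x) = x := F.apply_symm_apply
      -- Every cut-off vector is an admissible test function, so the weak equation holds against
      -- arbitrary `ψ` after moving `P` and `Q` to the other factor.
      have hfl : IsFracLaplacian σ (F.symm (P ψ)) (F.symm (Q ψ)) := by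
        change ∀ᵐ ξ : EuclideanSpace ℝ (Fin n), (F (F.symm (Q ψ))) ξ
          = ((2 * Real.pi * ‖ξ‖) ^ (2 * σ) : ℝ) • (F (F.symm (P ψ))) ξ
        rw [hF, hF]
        filter_upwards [coeFn_mulL2 hm₀ ψ, coeFn_mulL2 hm₁ ψ] with ξ h1 h2
        rw [h1, h2, ← freq_sq]
        by_cases hξ : ξ ∈ Z <;> simp [hξ]
      have e1 : ∀ x : L2 n, inner ℂ (F.symm (P ψ)) x = inner ℂ ψ (P (F x)) := by
        intro x
        rw [← F.inner_map_map, hF]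
        exact inner_mulL2_left hm₀ ψ (F x)
      have e2 : ∀ x : L2 n, inner ℂ (F.symm (Q ψ)) x = inner ℂ ψ (Q (F x)) := by
        intro x
        rw [← F.inner_map_map, hF]
        exact inner_mulL2_left hm₁ ψ (F x)
      have hd := (h.equation _ _ hfl t ht).sub (h'.equation _ _ hfl t ht)
      simp only [e1, e2] at hd
      refine (hd.congr_deriv ?_).congr (fun τ _ => ?_) ?_
      · simp only [W, U, b, V, map_sub, inner_sub_right, inner_neg_right, inner_smul_right]
        ring
      · simp only [b, V, map_sub, inner_sub_right, Pi.sub_apply]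
      · simp only [b, V, map_sub, inner_sub_right, Pi.sub_apply]
    have hQ : ∀ t, ‖Q (U t)‖ ≤ (R : ℝ) ^ 2 * ‖a t‖ := by
      intro t
      refine Lp.norm_le_mul_norm_of_ae_le_mul ?_
      filter_upwards [coeFn_mulL2 hm₀ (U t), coeFn_mulL2 hm₁ (U t)] with ξ h1 h2
      change ‖(mulL2 _ hm₁ (U t)) ξ‖ ≤ _ * ‖(mulL2 _ hm₀ (U t)) ξ‖
      rw [h1, h2]
      by_cases hξ : ξ ∈ Z
      · rw [Set.indicator_of_mem hξ, Set.indicator_of_mem hξ, norm_mul, Complex.norm_real,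
          Real.norm_eq_abs, abs_of_nonneg (by positivity)]
        simp only [Complex.ofReal_one, one_mul]
        have := freq_nonneg σ ξ
        gcongr
        exact hξ
      · simp [hξ]
    intro t ht
    -- First-order system for `(a, b)`: `a' = b` and `‖b'‖ ≤ R² ‖a‖ + μ ‖b‖`.
    have hzero := eq_zero_of_abs_deriv_le_mul_abs_self_of_eq_zero_right
      (f := fun r => (a r, b r)) (f' := fun r => (b r, W r)) (K := 1 + (R : ℝ) ^ 2 + μ)
      (a := s) (b := t)
      (fun r hr => ((had r hr.1).continuousWithinAt.prodMk (hbd r hr.1).continuousWithinAt).mono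
        fun x hx => hx.1)
      (fun r hr => (((had r hr.1).mono (Set.Ici_subset_Ici.2 hr.1)).prodMk
        ((hbd r hr.1).mono (Set.Ici_subset_Ici.2 hr.1))))
      (by simp [a, b, hU0, hV0])
      (fun r hr => by
        have hA : ‖a r‖ ≤ ‖(a r, b r)‖ := norm_fst_le (a r, b r)
        have hB : ‖b r‖ ≤ ‖(a r, b r)‖ := norm_snd_le (a r, b r)
        have hN : 0 ≤ ‖(a r, b r)‖ := norm_nonneg _
        have hsr : s ≤ r := hr.1
        have hc : ‖((μ / (1 + r) : ℝ) : ℂ)‖ ≤ μ := by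
          have h0 : 0 ≤ 1 + r := by linarith
          rw [Complex.norm_real, Real.norm_eq_abs, abs_of_nonneg (by positivity)]
          exact div_le_self hμ (by linarith)
        have hWn : ‖W r‖ ≤ (R : ℝ) ^ 2 * ‖(a r, b r)‖ + μ * ‖(a r, b r)‖ := by
          refine (norm_sub_le _ _).trans (add_le_add ?_ ?_)
          · rw [norm_neg]
            exact (hQ r).trans (by gcongr)
          · rw [norm_smul]
            gcongr
        rw [Prod.norm_def (b r, W r)]
        refine max_le ?_ ?_
        · change ‖b r‖ ≤ _
          have : 0 ≤ ((R : ℝ) ^ 2 + μ) * ‖(a r, b r)‖ := by positivity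
          linarith
        · change ‖W r‖ ≤ _
          linarith)
      t ⟨ht, le_rfl⟩
    have ha0 : P (U t) = 0 := congrArg Prod.fst hzero
    have hb0 : P (V t) = 0 := congrArg Prod.snd hzero
    filter_upwards [coeFn_mulL2 hm₀ (U t), coeFn_mulL2 hm₀ (V t),
      Lp.coeFn_zero ℂ 2 (volume : Measure (EuclideanSpace ℝ (Fin n)))] with ξ h1 h2 h3 hξ
    have hξ' : ξ ∈ Z := hξ
    change (P (U t)) ξ = _ at h1
    change (P (V t)) ξ = _ at h2
    rw [ha0, h3] at h1
    rw [hb0, h3] at h2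
    simp only [Set.indicator_of_mem hξ', Complex.ofReal_one, one_mul, Pi.zero_apply] at h1 h2
    exact ⟨h1.symm, h2.symm⟩
  have hall : ∀ᵐ ξ : EuclideanSpace ℝ (Fin n), U t ξ = 0 ∧ V t ξ = 0 := by
    filter_upwards [ae_all_iff.2 fun R : ℕ => key R t ht] with ξ hξ
    obtain ⟨R, hR⟩ := exists_nat_ge (freq σ ξ)
    exact hξ R hR
  have hU : U t = 0 := by
    refine Lp.ext ?_
    filter_upwards [hall, Lp.coeFn_zero ℂ 2 (volume : Measure (EuclideanSpace ℝ (Fin n)))]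
      with ξ h1 h2
    rw [h1.1, h2, Pi.zero_apply]
  have hV : V t = 0 := by
    refine Lp.ext ?_
    filter_upwards [hall, Lp.coeFn_zero ℂ 2 (volume : Measure (EuclideanSpace ℝ (Fin n)))]
      with ξ h1 h2
    rw [h1.2, h2, Pi.zero_apply]
  exact ⟨(sub_eq_zero.1 ((map_eq_zero_iff F F.injective).1 hU)).symm,
    (sub_eq_zero.1 ((map_eq_zero_iff F F.injective).1 hV)).symm⟩

/-! ### From multiplier norms to the decay estimates. -/

/-- The quantity `N (u(t)) (∂ₜu(t))` is the `L²` norm of a Fourier multiplier of order `b` applied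
to the data. -/
def IsMultiplierNorm (n : ℕ) (σ μ b : ℝ) (N : L2 n → L2 n → ℝ≥0∞) : Prop :=
  ∃ C₀ : ℝ, 0 < C₀ ∧ ∀ s : ℝ, 0 ≤ s → ∀ u₁ : L2 n, ∀ u v : ℝ → L2 n,
    IsEnergySolution σ μ s u₁ u v → ∀ t : ℝ, s ≤ t → ∃ κ : ℝ → ℝ, Measurable κ ∧
      IsZoneBounded μ b C₀ (1 + s) (1 + t) κ ∧
      N (u t) (v t) = eLpNorm (fun ξ => κ (freq σ ξ) • (𝓕 u₁ : L2 n) ξ) 2 volume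

/-- Uniqueness carries the explicit multiplier over to an arbitrary energy solution. -/
theorem isMultiplierNorm_homSobolevNorm {n : ℕ} {σ μ γ : ℝ} (hσ : 0 < σ) (hμ : 0 < μ)
    (hμ1 : μ ≠ 1) (hγ : γ ∈ Set.Icc 0 σ) :
    IsMultiplierNorm n σ μ (γ / σ) fun u _ => homSobolevNorm γ u := by
  obtain ⟨C₀, hC₀, H⟩ := IsDampedMode.exists_isZoneBounded hμ hμ1 (b := γ / σ)
    (div_nonneg hγ.1 hσ.le) ((div_le_one hσ).2 hγ.2)
  refine ⟨C₀, hC₀, fun s hs u₁ u v h t ht => ?_⟩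
  obtain ⟨f, g, hfg, hf, hg⟩ := exists_isDampedMode μ hs
  obtain ⟨u', v', h', hu', -⟩ := exists_isEnergySolution hσ.le hμ.le hs hfg hf hg u₁
  refine ⟨fun ρ => ρ ^ (γ / σ) * f ρ t, (measurable_id.pow_const _).mul (hf t),
    H s t f g hs ht hfg, ?_⟩
  rw [(h'.unique hμ.le hs h ht).1]
  refine eLpNorm_congr_ae ?_
  filter_upwards [hu' t ht] with ξ hξ
  have e : freq σ ξ ^ (γ / σ) = (2 * Real.pi * ‖ξ‖) ^ γ := by
    rw [freq, ← Real.rpow_mul (by positivity)]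
    congr 1
    field_simp
  rw [hξ, smul_smul, e]

/-- The order `1` is written `σ / σ` to match `γ / σ` at `γ = σ`. -/
theorem isMultiplierNorm_enorm_deriv {n : ℕ} {σ μ : ℝ} (hσ : 0 < σ) (hμ : 0 < μ) (hμ1 : μ ≠ 1) :
    IsMultiplierNorm n σ μ (σ / σ) fun _ v => ‖v‖ₑ := by
  obtain ⟨C₀, hC₀, H⟩ := IsDampedMode.exists_isZoneBounded_deriv hμ hμ1
  refine ⟨C₀, hC₀, fun s hs u₁ u v h t ht => ?_⟩
  obtain ⟨f, g, hfg, hf, hg⟩ := exists_isDampedMode μ hs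
  obtain ⟨u', v', h', -, hv'⟩ := exists_isEnergySolution hσ.le hμ.le hs hfg hf hg u₁
  refine ⟨fun ρ => g ρ t, hg t, ?_, ?_⟩
  · rw [div_self hσ.ne']
    exact H s t f g hs ht hfg
  · rw [(h'.unique hμ.le hs h ht).2]
    exact enorm_eq_of_fourier_ae_eq (hv' t ht)

theorem IsMultiplierNorm.solutionBound {n : ℕ} (hn : 1 ≤ n) {σ μ b : ℝ} (hσ : 0 < σ)
    {N : L2 n → L2 n → ℝ≥0∞} (hN : IsMultiplierNorm n σ μ b N) {W : ℝ → ℝ → ℝ}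
    {B : ℝ → ℝ → ℝ → ℝ → ℝ} {c : ℝ} (hc : 0 < c)
    (hW : ∀ s t, 0 ≤ s → s ≤ t → 0 ≤ W s t)
    (hL : ∀ s t, 0 ≤ s → 2 * (1 + s) ≤ 1 + t →
      annulusWeight (n / σ - 2 * (μ / 2 + 1 - min μ 1 - b)) (1 + s) (1 + t) ^ (1 / 2 : ℝ) ≤ W s t)
    (hB : ∀ s t x y, 0 ≤ s → s ≤ t → 0 ≤ x → 0 ≤ y →
      (1 + s) ^ min μ 1 * (1 + t) ^ (-(μ / 2)) *
        (W s t * x + (1 + s) ^ (μ / 2 + 1 - min μ 1 - b) * y) ≤ c * B s t x y) :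
    SolutionBound n σ μ N B := by
  obtain ⟨C₀, hC₀, H₀⟩ := hN
  obtain ⟨C, hC, H⟩ := IsZoneBounded.exists_eLpNorm_le hn (μ := μ) (b := b) hσ hC₀
  refine ⟨C * c, by positivity, fun s hs u₁ hu₁ u v h t ht => ?_⟩
  obtain ⟨κ, hκm, hκ, hNκ⟩ := H₀ s hs u₁ u v h t ht
  rw [hNκ]
  have hA : 0 ≤ ∫ x, ‖u₁ x‖ := integral_nonneg fun x => norm_nonneg (u₁ x)
  refine (H (1 + s) (1 + t) (W s t) (∫ x, ‖u₁ x‖) ‖u₁‖ κ _ (by linarith) (by linarith) hκ hκm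
    (Lp.aestronglyMeasurable _) hA (ae_norm_fourier_le_integral_norm u₁ hu₁) (norm_nonneg _)
    ?_ (hW s t hs ht) (hL s t hs)).trans (ENNReal.ofReal_le_ofReal ?_)
  · rw [← Lp.enorm_def, ← ofReal_norm, Lp.norm_fourier_eq]
  · rw [mul_assoc C c]
    exact mul_le_mul_of_nonneg_left (hB s t _ _ hs ht hA (norm_nonneg u₁)) hC.le

/-- Let `X = (e + t) / (e + s)`. Then `(1 + t) / (1 + s) ≤ e X`, so its logarithm is at most `1 +
log X`. The doubling assumption gives `X ≥ 1 + 1 / e`, and the summand `1` is absorbed by `log X`.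
-/
theorem exists_log_div_le : ∃ c : ℝ, 0 < c ∧ ∀ s t : ℝ, 0 ≤ s → 2 * (1 + s) ≤ 1 + t →
    Real.log ((1 + t) / (1 + s)) ≤ c * Real.log ((Real.exp 1 + t) / (Real.exp 1 + s)) := by
  have he : 1 < Real.exp 1 := Real.one_lt_exp_iff.2 one_pos
  have hl : 0 < Real.log (1 + (Real.exp 1)⁻¹) := Real.log_pos (by simp; positivity)
  refine ⟨(Real.log (1 + (Real.exp 1)⁻¹))⁻¹ + 1, by positivity, fun s t hs hst => ?_⟩
  set X := (Real.exp 1 + t) / (Real.exp 1 + s) with hX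
  have hs' : 0 < Real.exp 1 + s := by linarith
  have hX1 : 1 + (Real.exp 1)⁻¹ ≤ X := by
    rw [hX, le_div_iff₀ hs']
    have h1 : (1 + (Real.exp 1)⁻¹) * (Real.exp 1 + s) =
        Real.exp 1 + s + 1 + (Real.exp 1)⁻¹ * s := by
      field_simp
      ring
    have h2 : (Real.exp 1)⁻¹ * s ≤ s := mul_le_of_le_one_left hs (inv_le_one_of_one_le₀ he.le)
    linarith
  have hX0 : 0 < X := lt_of_lt_of_le (by positivity) hX1
  have h1 : (1 + t) / (1 + s) ≤ Real.exp 1 * X := by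
    rw [hX, mul_div_assoc', div_le_div_iff₀ (by linarith) hs']
    have ht : 0 ≤ t := by linarith
    nlinarith [mul_nonneg (mul_nonneg hs ht) (sub_nonneg.2 he.le), mul_nonneg hs (sub_nonneg.2 he.le)]
  calc Real.log ((1 + t) / (1 + s)) ≤ Real.log (Real.exp 1 * X) := by
        refine Real.log_le_log (div_pos (by linarith) (by linarith)) h1
    _ = 1 + Real.log X := by rw [Real.log_mul (by positivity) hX0.ne', Real.log_exp]
    _ ≤ (Real.log (1 + (Real.exp 1)⁻¹))⁻¹ * Real.log X + Real.log X := by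
        gcongr
        rw [inv_mul_eq_div, one_le_div hl]
        exact Real.log_le_log (by positivity) hX1
    _ = _ := by ring

namespace IsMultiplierNorm

variable {n : ℕ} {σ μ b : ℝ} {N : L2 n → L2 n → ℝ≥0∞}

/-- The frequencies near `1 / T` dominate. In the `L²` term, `S ^ e = S ^ (-θ / 2) S ^ (n / (2 σ))`,
and `S ^ (-θ / 2) ≤ T ^ (-θ / 2)` because `θ < 0`. -/
theorem solutionBound_of_neg (hn : 1 ≤ n) (hσ : 0 < σ) (hN : IsMultiplierNorm n σ μ b N)
    (hθ : n / σ - 2 * (μ / 2 + 1 - min μ 1 - b) < 0) :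
    SolutionBound n σ μ N fun s t x y =>
      (1 + t) ^ (1 - min μ 1 - n / (2 * σ) - b) * (1 + s) ^ min μ 1 *
        (x + (1 + s) ^ (n / (2 * σ)) * y) := by
  have hn2 : (n : ℝ) / (2 * σ) = n / σ / 2 := by field_simp
  set θ := n / σ - 2 * (μ / 2 + 1 - min μ 1 - b) with hθdef
  refine hN.solutionBound hn hσ (W := fun _ t => (1 + t) ^ (-θ / 2)) one_pos
    (fun s t hs ht => ?_) (fun s t hs ht => ?_) fun s t x y hs ht hx hy => ?_
  · have : 0 ≤ 1 + t := by linarith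
    positivity
  · rw [annulusWeight, if_pos hθ, ← Real.rpow_mul (by linarith)]
    exact le_of_eq (by congr 1; ring)
  · have hS : 0 < 1 + s := by linarith
    have hT : 0 < 1 + t := by linarith
    have hST : 1 + s ≤ 1 + t := by linarith
    have e1 : (1 + s) ^ (μ / 2 + 1 - min μ 1 - b) ≤
        (1 + t) ^ (-θ / 2) * (1 + s) ^ (n / (2 * σ)) := by
      calc _ = (1 + s) ^ (-θ / 2) * (1 + s) ^ (n / (2 * σ)) := by
            rw [← Real.rpow_add hS]
            congr 1
            rw [hn2, hθdef]
            ring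
        _ ≤ _ := by
            gcongr
            linarith
    have e2 : (1 + t) ^ (1 - min μ 1 - n / (2 * σ) - b) =
        (1 + t) ^ (-(μ / 2)) * (1 + t) ^ (-θ / 2) := by
      rw [← Real.rpow_add hT]
      congr 1
      rw [hn2, hθdef]
      ring
    calc _ ≤ (1 + s) ^ min μ 1 * (1 + t) ^ (-(μ / 2)) * ((1 + t) ^ (-θ / 2) * x +
          ((1 + t) ^ (-θ / 2) * (1 + s) ^ (n / (2 * σ))) * y) := by gcongr
      _ = _ := by
          rw [e2]
          ring

/-- The frequencies near `1 / S` dominate, so both terms carry the same factor `S ^ (-θ / 2)`. -/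
theorem solutionBound_of_pos (hn : 1 ≤ n) (hσ : 0 < σ) (hN : IsMultiplierNorm n σ μ b N)
    (hθ : 0 < n / σ - 2 * (μ / 2 + 1 - min μ 1 - b)) :
    SolutionBound n σ μ N fun s t x y =>
      (1 + t) ^ (-(μ / 2)) * (1 + s) ^ (1 + μ / 2 - n / (2 * σ) - b) *
        (x + (1 + s) ^ (n / (2 * σ)) * y) := by
  have hn2 : (n : ℝ) / (2 * σ) = n / σ / 2 := by field_simp
  set θ := n / σ - 2 * (μ / 2 + 1 - min μ 1 - b) with hθdef
  refine hN.solutionBound hn hσ (W := fun s _ => (1 + s) ^ (-θ / 2)) one_pos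
    (fun s t hs ht => ?_) (fun s t hs ht => ?_) fun s t x y hs ht hx hy => ?_
  · positivity
  · rw [annulusWeight, if_neg hθ.not_gt, if_neg hθ.ne', ← Real.rpow_mul (by linarith)]
    exact le_of_eq (by congr 1; ring)
  · have hS : 0 < 1 + s := by linarith
    have e1 : (1 + s) ^ (μ / 2 + 1 - min μ 1 - b) =
        (1 + s) ^ (-θ / 2) * (1 + s) ^ (n / (2 * σ)) := by
      rw [← Real.rpow_add hS]
      congr 1
      rw [hn2, hθdef]
      ring
    have e2 : (1 + s) ^ (1 + μ / 2 - n / (2 * σ) - b) =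
        (1 + s) ^ min μ 1 * (1 + s) ^ (-θ / 2) := by
      rw [← Real.rpow_add hS]
      congr 1
      rw [hn2, hθdef]
      ring
    rw [e1, e2]
    exact le_of_eq (by ring)

/-- All dyadic frequency shells between `1 / T` and `1 / S` contribute equally, and the square root
of their number is the logarithmic factor. The `L²` term has no logarithm since `e = n / (2 σ)`. -/
theorem solutionBound_of_eq (hn : 1 ≤ n) (hσ : 0 < σ) (hN : IsMultiplierNorm n σ μ b N)
    (hθ : n / σ - 2 * (μ / 2 + 1 - min μ 1 - b) = 0) :
    SolutionBound n σ μ N fun s t x y =>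
      (1 + t) ^ (-(μ / 2)) * (1 + s) ^ min μ 1 *
        (Real.log ((Real.exp 1 + t) / (Real.exp 1 + s)) ^ (1 / 2 : ℝ) * x +
          (1 + s) ^ (n / (2 * σ)) * y) := by
  have hn2 : (n : ℝ) / (2 * σ) = n / σ / 2 := by field_simp
  obtain ⟨c, hc, H⟩ := exists_log_div_le
  have hlog : ∀ s t : ℝ, 0 ≤ s → s ≤ t →
      0 ≤ Real.log ((Real.exp 1 + t) / (Real.exp 1 + s)) := by
    intro s t hs ht
    have : 0 < Real.exp 1 := Real.exp_pos 1
    exact Real.log_nonneg ((one_le_div (by linarith)).2 (by linarith))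
  refine hN.solutionBound hn hσ (c := 1 + c ^ (1 / 2 : ℝ)) (W := fun s t => c ^ (1 / 2 : ℝ) *
    Real.log ((Real.exp 1 + t) / (Real.exp 1 + s)) ^ (1 / 2 : ℝ)) (by positivity)
    (fun s t hs ht => ?_) (fun s t hs ht => ?_) fun s t x y hs ht hx hy => ?_
  · have := hlog s t hs ht
    positivity
  · rw [annulusWeight, hθ, if_neg (lt_irrefl _), if_pos rfl,
      ← Real.mul_rpow hc.le (hlog s t hs (by linarith))]
    refine Real.rpow_le_rpow (Real.log_nonneg ?_) (H s t hs ht) (by norm_num)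
    exact (one_le_div (by linarith)).2 (by linarith)
  · have hS : 0 < 1 + s := by linarith
    have hT : 0 < 1 + t := by linarith
    have hl := hlog s t hs ht
    have e1 : μ / 2 + 1 - min μ 1 - b = n / (2 * σ) := by
      rw [hn2]
      linarith
    rw [e1]
    set l := Real.log ((Real.exp 1 + t) / (Real.exp 1 + s)) ^ (1 / 2 : ℝ) with hldef
    have hl0 : 0 ≤ l := Real.rpow_nonneg hl _
    have hc0 : 0 ≤ c ^ (1 / 2 : ℝ) := by positivity
    calc _ ≤ (1 + s) ^ min μ 1 * (1 + t) ^ (-(μ / 2)) * ((1 + c ^ (1 / 2 : ℝ)) * l * x +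
          (1 + c ^ (1 / 2 : ℝ)) * (1 + s) ^ (n / (2 * σ)) * y) := by
          gcongr
          · linarith
          · exact le_mul_of_one_le_left (by positivity) (by linarith)
      _ = _ := by ring

end IsMultiplierNorm

/-- With `b = γ / σ`, the exponent `θ` equals `(n + 2 γ) / σ - μ` for `μ > 1` and `μ - (2 - n / σ -
2 γ / σ)` for `μ < 1`, so the thresholds of the theorem are its sign changes. Every regime excludes
`μ = 1`. -/
theorem decayEstimates_of_isMultiplierNorm {n : ℕ} (hn : 1 ≤ n) {σ μ γ : ℝ} (hσ : 0 < σ)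
    {N : L2 n → L2 n → ℝ≥0∞} (hN : μ ≠ 1 → IsMultiplierNorm n σ μ (γ / σ) N) :
    DecayEstimates n σ μ γ N := by
  have hn2 : (n : ℝ) / (2 * σ) = n / σ / 2 := by field_simp
  have hdiv : ((n : ℝ) + 2 * γ) / σ = n / σ + 2 * (γ / σ) := by ring
  have hdiv2 : 2 * γ / σ = 2 * (γ / σ) := by ring
  unfold DecayEstimates
  rw [hdiv, hdiv2]
  refine ⟨fun h => ?_, fun h => ?_, fun h => ?_, fun h => ?_, fun h => ?_⟩
  · obtain ⟨h1, h2⟩ := max_lt_iff.1 h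
    have hm : min μ 1 = 1 := min_eq_right h2.le
    have := (hN h2.ne').solutionBound_of_neg hn hσ (by rw [hm]; linarith)
    simp only [hm, Real.rpow_one, sub_self, zero_sub] at this
    exact this
  · rcases h with ⟨h1, h2⟩ | ⟨h1, h2⟩
    · have hm : min μ 1 = μ := min_eq_left h2.le
      have h3 := (max_lt_iff.1 h1).1
      exact (hN h2.ne).solutionBound_of_pos hn hσ (by rw [hm]; linarith)
    · have hm : min μ 1 = 1 := min_eq_right h1.le
      exact (hN h1.ne').solutionBound_of_pos hn hσ (by rw [hm]; linarith)
  · obtain ⟨h1, h2⟩ := h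
    have hm : min μ 1 = 1 := min_eq_right h2.le
    have := (hN h2.ne').solutionBound_of_eq hn hσ (by rw [hm]; linarith)
    simp only [hm, Real.rpow_one] at this
    exact this
  · obtain ⟨h1, h2⟩ := h
    have hm : min μ 1 = μ := min_eq_left h2.le
    have := (hN h2.ne).solutionBound_of_eq hn hσ (by rw [hm]; linarith)
    have e : (n : ℝ) / (2 * σ) - 1 + γ / σ = -(μ / 2) := by
      rw [hn2]
      linarith
    rw [hm] at this
    rw [e]
    exact this
  · obtain ⟨h1, h2⟩ := h
    obtain ⟨h3, h4⟩ := lt_min_iff.1 h2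
    have hm : min μ 1 = μ := min_eq_left h4.le
    have := (hN h4.ne).solutionBound_of_neg hn hσ (by rw [hm]; linarith)
    rw [hm] at this
    exact this

theorem theorem3p5 (n : ℕ) (hn : 1 ≤ n) (σ μ : ℝ) (hσ : 1 < σ) (hnσ : (n : ℝ) < 2 * σ)
    (hμ : 0 < μ) :
    -- the Cauchy problem has one and only one energy solution
    (∀ s : ℝ, 0 ≤ s → ∀ u₁ : L2 n, Integrable u₁ volume →
      ∃ u v : ℝ → L2 n, IsEnergySolution σ μ s u₁ u v ∧
        ∀ u' v' : ℝ → L2 n, IsEnergySolution σ μ s u₁ u' v' →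
          Set.EqOn u' u (Set.Ici s) ∧ Set.EqOn v' v (Set.Ici s)) ∧
    -- the estimates of its homogeneous Sobolev norms
    (∀ γ ∈ Set.Icc 0 σ, DecayEstimates n σ μ γ fun u _ => homSobolevNorm γ u) ∧
    -- the time derivative satisfies the estimates of the order `σ`
    DecayEstimates n σ μ σ (fun _ v => ‖v‖ₑ) := by
  have hσ0 : 0 < σ := by linarith
  refine ⟨fun s hs u₁ _ => ?_, fun γ hγ => ?_, ?_⟩
  · obtain ⟨f, g, hfg, hf, hg⟩ := exists_isDampedMode μ hs
    obtain ⟨u, v, h, -, -⟩ := exists_isEnergySolution hσ0.le hμ.le hs hfg hf hg u₁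
    exact ⟨u, v, h, fun u' v' h' => ⟨fun t ht => (h.unique hμ.le hs h' ht).1,
      fun t ht => (h.unique hμ.le hs h' ht).2⟩⟩
  · exact decayEstimates_of_isMultiplierNorm hn hσ0 fun hμ1 =>
      isMultiplierNorm_homSobolevNorm hσ0 hμ hμ1 hγ
  · exact decayEstimates_of_isMultiplierNorm hn hσ0 fun hμ1 =>
      isMultiplierNorm_enorm_deriv hσ0 hμ hμ1
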